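/- Let $0<\delta<1$ and $R_\delta=\{z\in\mathbb C:\delta<|z|<1\}$. For a holomorphic function $\varphi$ on $R_\delta$ put $$\|\varphi\|_{\mathrm{dp}}=\sup\{\|\varphi(X)\|\}\in[0,\infty],$$ where the supremum is over all bounded invertible operators $X$ on complex Hilbert spaces with $\|X\|\le 1$, $\|X^{-1}\|\le 1/\delta$ and spectrum $\sigma(X)\subseteq R_\delta$, and $\varphi(X)$ is given by the Riesz–Dunford functional calculus. Let $\lambda_1,\dots,\lambda_n$ be distinct points of $R_\delta$ and let $z_1,\dots,z_n\in\mathbb C$. Denote by $\mathcal G_{\mathrm{dp}}(\lambda)$ the set of all positive definite $n\times n$ complex matrices $g=[g_{ij}]$ such that $$\big[(1-\overline{\lambda_i}\lambda_j)g_{ij}\big]_{i,j=1}^n\ge 0\quad\text{and}\quad\Big[\Big(1-\frac{\delta}{\overline{\lambda_i}}\frac{\delta}{\lambda_j}\Big)g_{ij}\Big]_{i,j=1}^n\ge 0,$$ where $\ge 0$ means positive semi-definite. The DP Pick problem $\lambda_j\mapsto z_j$ ($j=1,\dots,n$) is called extremally solvable if there is a holomorphic $\varphi$ on $R_\delta$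 with $\|\varphi\|_{\mathrm{dp}}\le 1$ and $\varphi(\lambda_j)=z_j$ for $j=1,\dots,n$, but there is no holomorphic $\varphi$ on $R_\delta$ with $\|\varphi\|_{\mathrm{dp}}<1$ and $\varphi(\lambda_j)=z_j$ for $j=1,\dots,n$. **Theorem 6.2.** The following two statements are equivalent. (i) The DP Pick problem $\lambda_j\mapsto z_j$, $j=1,\dots,n$, is extremally solvable. (ii) For all $g\in\mathcal G_{\mathrm{dp}}(\lambda)$, $$\big[(1-\overline{z_i}z_j)g_{ij}\big]_{i,j=1}^n\ge 0,$$ and there exists $\widetilde g\in\mathcal G_{\mathrm{dp}}(\lambda)$ such that $$\operatorname{rank}\big[(1-\overline{z_i}z_j)\widetilde g_{ij}\big]_{i,j=1}^n<n.$$ -/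

import Mathlib

open scoped ComplexConjugate ComplexOrder ENNReal

universe u

namespace DPPick

/-- The open annulus `R_δ = {z : δ < |z| < 1}`. -/
def annulus (δ : ℝ) : Set ℂ := {z | δ < ‖z‖ ∧ ‖z‖ < 1}

section Calculus

variable {H : Type u} [NormedAddCommGroup H] [InnerProductSpace ℂ H]

/-- `X` is a Douglas-Paulsen operator with parameter `δ`: it is invertible in the algebra of
bounded operators, `‖X‖ ≤ 1` and `‖X⁻¹‖ ≤ 1/δ`. -/
def IsDouglasPaulsen (δ : ℝ) (X : H →L[ℂ] H) : Prop :=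
  IsUnit X ∧ ‖X‖ ≤ 1 ∧ ‖Ring.inverse X‖ ≤ 1 / δ

/-- `X` belongs to the Douglas-Paulsen family: it is a Douglas-Paulsen operator with
`σ(X) ⊆ R_δ`. -/
def InDPFamily (δ : ℝ) (X : H →L[ℂ] H) : Prop :=
  IsDouglasPaulsen δ X ∧ spectrum ℂ X ⊆ annulus δ

/-- The circles `|z| = r` and `|z| = R` lie in `R_δ` and the spectrum of `X` lies strictly
between them. -/
def IsAdmissible (δ : ℝ) (X : H →L[ℂ] H) (r R : ℝ) : Prop :=
  δ < r ∧ r < R ∧ R < 1 ∧ ∀ z ∈ spectrum ℂ X, r < ‖z‖ ∧ ‖z‖ < R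

/-- The Cauchy integral `(1/2πi) ∫ φ(z) (z - X)⁻¹ dz` over the boundary of the annulus
`r < |z| < R`, the outer circle being positively and the inner one negatively oriented. -/
noncomputable def contourIntegral (φ : ℂ → ℂ) (X : H →L[ℂ] H) (r R : ℝ) : H →L[ℂ] H :=
  (2 * Real.pi * Complex.I)⁻¹ •
    ((∮ z in C(0, R), φ z • resolvent X z) - ∮ z in C(0, r), φ z • resolvent X z)

open Classical in
/-- The Riesz-Dunford functional calculus `φ(X)` for `φ` holomorphic on `R_δ` and
`σ(X) ⊆ R_δ`: the Cauchy integral over any pair of admissible circles. Such circles exist by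
`exists_isAdmissible`, and the choice is immaterial by `calculus_eq_contourIntegral`. -/
noncomputable def calculus (δ : ℝ) (φ : ℂ → ℂ) (X : H →L[ℂ] H) : H →L[ℂ] H :=
  if h : ∃ p : ℝ × ℝ, IsAdmissible δ X p.1 p.2 then
    contourIntegral φ X h.choose.1 h.choose.2
  else 0

variable [CompleteSpace H]

theorem exists_isAdmissible {δ : ℝ} (hδ1 : δ < 1) {X : H →L[ℂ] H}
    (hX : spectrum ℂ X ⊆ annulus δ) : ∃ p : ℝ × ℝ, IsAdmissible δ X p.1 p.2 := by
  have hc : IsCompact (spectrum ℂ X) := spectrum.isCompact X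
  rcases (spectrum ℂ X).eq_empty_or_nonempty with h | h
  · refine ⟨((2 * δ + 1) / 3, (δ + 2) / 3), ?_, ?_, ?_, ?_⟩
    · show δ < (2 * δ + 1) / 3
      linarith
    · show (2 * δ + 1) / 3 < (δ + 2) / 3
      linarith
    · show (δ + 2) / 3 < 1
      linarith
    · simp [h]
  · obtain ⟨a, ha, hmin⟩ := hc.exists_isMinOn h continuous_norm.continuousOn
    obtain ⟨b, hb, hmax⟩ := hc.exists_isMaxOn h continuous_norm.continuousOn
    have ha' := hX ha
    have hb' := hX hb
    have hab : ‖a‖ ≤ ‖b‖ := hmin hb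
    refine ⟨((δ + ‖a‖) / 2, (‖b‖ + 1) / 2), ?_, ?_, ?_, ?_⟩
    · show δ < (δ + ‖a‖) / 2
      linarith [ha'.1]
    · show (δ + ‖a‖) / 2 < (‖b‖ + 1) / 2
      linarith [ha'.1, hb'.2]
    · show (‖b‖ + 1) / 2 < 1
      linarith [hb'.2]
    · intro z hz
      have h1 : ‖a‖ ≤ ‖z‖ := hmin hz
      have h2 : ‖z‖ ≤ ‖b‖ := hmax hz
      exact ⟨by show (δ + ‖a‖) / 2 < ‖z‖; linarith [ha'.1],
        by show ‖z‖ < (‖b‖ + 1) / 2; linarith [hb'.2]⟩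

theorem circleIntegral_resolvent_eq {δ : ℝ} (hδ : 0 < δ) {φ : ℂ → ℂ}
    (hφ : DifferentiableOn ℂ φ (annulus δ)) {X : H →L[ℂ] H} {s t : ℝ}
    (hs : δ < s) (hst : s ≤ t) (ht : t < 1)
    (hX : ∀ z ∈ spectrum ℂ X, ‖z‖ < s ∨ t < ‖z‖) :
    (∮ z in C(0, t), φ z • resolvent X z) = ∮ z in C(0, s), φ z • resolvent X z := by
  have key : ∀ z : ℂ, s ≤ ‖z‖ → ‖z‖ ≤ t →
      DifferentiableAt ℂ (fun z => φ z • resolvent X z) z := by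
    intro z h1 h2
    have hopen : IsOpen (annulus δ) :=
      (isOpen_lt continuous_const continuous_norm).inter
        (isOpen_lt continuous_norm continuous_const)
    have hz : z ∈ annulus δ := ⟨by linarith, by linarith⟩
    have hz' : z ∈ resolventSet ℂ X := by
      by_contra hcon
      rcases hX z hcon with h | h <;> linarith
    exact ((hφ z hz).differentiableAt (hopen.mem_nhds hz)).smul
      (spectrum.hasDerivAt_resolvent_const_left hz').differentiableAt
  refine Complex.circleIntegral_eq_of_differentiable_on_annulus_off_countable
    (hδ.trans hs) hst Set.countable_empty ?_ ?_
  · intro z hz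
    have h1 : ‖z‖ ≤ t := by simpa using hz.1
    have h2 : s ≤ ‖z‖ := by simpa using hz.2
    exact (key z h2 h1).continuousAt.continuousWithinAt
  · intro z hz
    have h1 : ‖z‖ < t := by simpa using hz.1.1
    have h2 : s < ‖z‖ := by simpa using hz.1.2
    exact key z h2.le h1.le

theorem contourIntegral_eq {δ : ℝ} (hδ : 0 < δ) {φ : ℂ → ℂ}
    (hφ : DifferentiableOn ℂ φ (annulus δ)) {X : H →L[ℂ] H} {r R r' R' : ℝ}
    (h : IsAdmissible δ X r R) (h' : IsAdmissible δ X r' R') :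
    contourIntegral φ X r R = contourIntegral φ X r' R' := by
  obtain ⟨h1, h2, h3, h4⟩ := h
  obtain ⟨h1', h2', h3', h4'⟩ := h'
  have e1 : (∮ z in C(0, R), φ z • resolvent X z) = ∮ z in C(0, R'), φ z • resolvent X z := by
    rcases le_total R R' with hR | hR
    · exact (circleIntegral_resolvent_eq hδ hφ (h1.trans h2) hR h3'
        fun z hz => Or.inl (h4 z hz).2).symm
    · exact circleIntegral_resolvent_eq hδ hφ (h1'.trans h2') hR h3
        fun z hz => Or.inl (h4' z hz).2
  have e2 : (∮ z in C(0, r), φ z • resolvent X z) = ∮ z in C(0, r'), φ z • resolvent X z := by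
    rcases le_total r r' with hr | hr
    · exact (circleIntegral_resolvent_eq hδ hφ h1 hr (h2'.trans h3')
        fun z hz => Or.inr (h4' z hz).1).symm
    · exact circleIntegral_resolvent_eq hδ hφ h1' hr (h2.trans h3)
        fun z hz => Or.inr (h4 z hz).1
  rw [contourIntegral, contourIntegral, e1, e2]

theorem calculus_eq_contourIntegral {δ : ℝ} (hδ : 0 < δ) {φ : ℂ → ℂ}
    (hφ : DifferentiableOn ℂ φ (annulus δ)) {X : H →L[ℂ] H} {r R : ℝ}
    (h : IsAdmissible δ X r R) : calculus δ φ X = contourIntegral φ X r R := by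
  have hex : ∃ p : ℝ × ℝ, IsAdmissible δ X p.1 p.2 := ⟨(r, R), h⟩
  rw [calculus, dif_pos hex]
  exact contourIntegral_eq hδ hφ hex.choose_spec h

end Calculus

/-- The Douglas-Paulsen norm `‖φ‖_dp = sup ‖φ(X)‖`, with value in `[0, ∞]`, the supremum being
over all `X` in the Douglas-Paulsen family on all complex Hilbert spaces `H` (of a universe `u`;
as `‖φ(X)‖` is determined by the separable subspaces that reduce `X`, nothing depends on `u`). -/
noncomputable def dpNorm (δ : ℝ) (φ : ℂ → ℂ) : ℝ≥0∞ :=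
  ⨆ (H : Type u) (_ : NormedAddCommGroup H) (_ : InnerProductSpace ℂ H) (_ : CompleteSpace H)
    (X : H →L[ℂ] H) (_ : InDPFamily δ X), ‖calculus δ φ X‖ₑ

/-- The space `H^∞_dp(R_δ)` of holomorphic functions on `R_δ` with finite dp-norm. Functions
on `R_δ` are represented by functions on `ℂ`, whose values off `R_δ` play no part. -/
def HInfDP (δ : ℝ) : Set (ℂ → ℂ) :=
  {φ | DifferentiableOn ℂ φ (annulus δ) ∧ dpNorm.{u} δ φ < ∞}

/-- The dp-Schur class: holomorphic functions on `R_δ` of dp-norm at most `1`. -/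
def schurDP (δ : ℝ) : Set (ℂ → ℂ) :=
  {φ | DifferentiableOn ℂ φ (annulus δ) ∧ dpNorm.{u} δ φ ≤ 1}

/-- The DP Pick problem `lam j ↦ z j` is solvable. -/
def Solvable (δ : ℝ) {n : ℕ} (lam z : Fin n → ℂ) : Prop :=
  ∃ φ ∈ schurDP.{u} δ, ∀ j, φ (lam j) = z j

/-- The DP Pick problem `lam j ↦ z j` is extremally solvable. -/
def ExtremallySolvable (δ : ℝ) {n : ℕ} (lam z : Fin n → ℂ) : Prop :=
  Solvable.{u} δ lam z ∧
    ¬ ∃ φ ∈ HInfDP.{u} δ, dpNorm.{u} δ φ < 1 ∧ ∀ j, φ (lam j) = z j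

/-- The matrix `[(1 - w̄_i w_j) g_ij]`. -/
def pickMatrix {n : ℕ} (w : Fin n → ℂ) (g : Matrix (Fin n) (Fin n) ℂ) :
    Matrix (Fin n) (Fin n) ℂ :=
  Matrix.of fun i j => (1 - conj (w i) * w j) * g i j

/-- The set of DP-Szegő kernels for the tuple `lam`: the positive definite matrices `g` with
`[(1 - λ̄_i λ_j) g_ij] ≥ 0` and `[(1 - (δ/λ̄_i) (δ/λ_j)) g_ij] ≥ 0`. -/
def dpKernels (δ : ℝ) {n : ℕ} (lam : Fin n → ℂ) : Set (Matrix (Fin n) (Fin n) ℂ) :=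
  {g | g.PosDef ∧ (pickMatrix lam g).PosSemidef ∧
    (Matrix.of fun i j => (1 - ((δ : ℂ) / conj (lam i)) * ((δ : ℂ) / lam j)) * g i j).PosSemidef}

end DPPick

namespace DPPick

/-! Kernels and operators correspond. If `g = Sᴴ * S` is a DP-Szegő kernel, then `X = S diag(λ) S⁻¹`
belongs to the Douglas-Paulsen family, and `φ(X) = S diag(φ(λ)) S⁻¹`. Hence a dp-norm bound `r` on
`φ` forces `[(r² - z̄_i z_j) g_ij] ≥ 0` (`kernelMatrix_posSemidef_of_dpNorm_le`). With `r = 1` this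
is the Pick condition. With `r < 1` it makes every Pick matrix at least `(1 - r²) g`, hence of full
rank (`rank_eq_of_dpNorm_lt_one`).

Conversely, the matrices `[(1 - λ̄_i λ_j) A_ij + (1 - (δ/λ̄_i)(δ/λ_j)) B_ij]` with `A, B ≥ 0` form a
closed convex cone. Separating `[1 - z̄_i z_j]` from it would produce a kernel violating the Pick
condition (`mem_modelCone_of_forall_dualKernels`), so a decomposition exists. A lurking isometry
turns it into a unitary `U` whose transfer function interpolates and is contractive on the
Douglas-Paulsen family (`solvable_of_eq_kernelMatrix_add`).

For extremality, suppose that the Pick condition holds and no Pick matrix is singular. Compactness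
of the semidefinite kernels of trace one then leaves a uniform margin `ε`
(`exists_pos_forall_dualKernels_le`), so the slightly enlarged data `z_j / r` with `r < 1` remain
solvable, and multiplying by `r` gives a solution of norm less than `1`. The limiting kernels may be
degenerate. Because the nodes are distinct, the null space of such a kernel is spanned by coordinate
vectors and can be repaired by a diagonal term (`posDef_add_diagonal_zeroIndicator`). -/

theorem isOpen_annulus (δ : ℝ) : IsOpen (annulus δ) :=
  (isOpen_lt continuous_const continuous_norm).inter (isOpen_lt continuous_norm continuous_const)

theorem ne_zero_of_mem_annulus {δ : ℝ} (hδ : 0 < δ) {z : ℂ} (hz : z ∈ annulus δ) : z ≠ 0 :=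
  norm_pos_iff.1 (hδ.trans hz.1)

theorem circleIntegral_clm_comp {E F : Type*} [NormedAddCommGroup E] [NormedSpace ℂ E]
    [CompleteSpace E] [NormedAddCommGroup F] [NormedSpace ℂ F] [CompleteSpace F]
    (L : E →L[ℂ] F) {f : ℂ → E} {c : ℂ} {R : ℝ} (hf : CircleIntegrable f c R) :
    (∮ z in C(c, R), L (f z)) = L (∮ z in C(c, R), f z) := by
  simp only [circleIntegral, ← L.map_smul]
  exact L.intervalIntegral_comp_comm hf.out

/-! ### Algebra of the Riesz-Dunford calculus -/

section Calculus

variable {H : Type u} [NormedAddCommGroup H] [InnerProductSpace ℂ H] [CompleteSpace H]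

theorem circleIntegrable_smul_resolvent {δ t : ℝ} {φ : ℂ → ℂ}
    (hφ : DifferentiableOn ℂ φ (annulus δ)) {X : H →L[ℂ] H} (ht0 : 0 ≤ t) (ht : δ < t)
    (ht1 : t < 1) (hX : ∀ z ∈ spectrum ℂ X, ‖z‖ ≠ t) :
    CircleIntegrable (fun z => φ z • resolvent X z) 0 t := by
  refine ContinuousOn.circleIntegrable ht0 fun z hz => ?_
  have hzt : ‖z‖ = t := by simpa using hz
  have hza : z ∈ annulus δ := ⟨hzt ▸ ht, hzt ▸ ht1⟩
  have hzr : z ∈ resolventSet ℂ X := by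
    by_contra hcon
    exact hX z hcon hzt
  exact (((hφ z hza).differentiableAt ((isOpen_annulus δ).mem_nhds hza)).smul
    (spectrum.hasDerivAt_resolvent_const_left hzr).differentiableAt).continuousAt.continuousWithinAt

namespace IsAdmissible

variable {δ r R : ℝ} {X : H →L[ℂ] H} {φ : ℂ → ℂ}

theorem circleIntegrable_outer (h : IsAdmissible δ X r R) (hδ : 0 < δ)
    (hφ : DifferentiableOn ℂ φ (annulus δ)) :
    CircleIntegrable (fun z => φ z • resolvent X z) 0 R :=
  circleIntegrable_smul_resolvent hφ (hδ.trans (h.1.trans h.2.1)).le (h.1.trans h.2.1) h.2.2.1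
    fun z hz => (h.2.2.2 z hz).2.ne

theorem circleIntegrable_inner (h : IsAdmissible δ X r R) (hδ : 0 < δ)
    (hφ : DifferentiableOn ℂ φ (annulus δ)) :
    CircleIntegrable (fun z => φ z • resolvent X z) 0 r :=
  circleIntegrable_smul_resolvent hφ (hδ.trans h.1).le h.1 (h.2.1.trans h.2.2.1)
    fun z hz => (h.2.2.2 z hz).1.ne'

end IsAdmissible

variable {δ : ℝ} {X : H →L[ℂ] H}

theorem calculus_congr (hδ : 0 < δ) (hδ1 : δ < 1) (hX : spectrum ℂ X ⊆ annulus δ) {φ ψ : ℂ → ℂ}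
    (hφ : DifferentiableOn ℂ φ (annulus δ)) (h : Set.EqOn φ ψ (annulus δ)) :
    calculus δ φ X = calculus δ ψ X := by
  obtain ⟨⟨r, R⟩, hrR⟩ := exists_isAdmissible hδ1 hX
  obtain ⟨h1, h2, h3, -⟩ := id hrR
  dsimp only at h1 h2 h3
  rw [calculus_eq_contourIntegral hδ hφ hrR,
    calculus_eq_contourIntegral hδ (hφ.congr fun z hz => (h hz).symm) hrR]
  unfold contourIntegral
  congr 2
  · refine circleIntegral.integral_congr (by linarith) fun z hz => ?_
    have hz' : ‖z‖ = R := by simpa using hz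
    simp only [h (show z ∈ annulus δ from ⟨by linarith, by linarith⟩)]
  · refine circleIntegral.integral_congr (by linarith) fun z hz => ?_
    have hz' : ‖z‖ = r := by simpa using hz
    simp only [h (show z ∈ annulus δ from ⟨by linarith, by linarith⟩)]

theorem calculus_sum (hδ : 0 < δ) (hδ1 : δ < 1) (hX : spectrum ℂ X ⊆ annulus δ) {ι : Type*}
    (s : Finset ι) (c : ι → ℂ) {φ : ι → ℂ → ℂ}
    (hφ : ∀ i, DifferentiableOn ℂ (φ i) (annulus δ)) :
    calculus δ (fun z => ∑ i ∈ s, c i * φ i z) X = ∑ i ∈ s, c i • calculus δ (φ i) X := by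
  obtain ⟨⟨r, R⟩, hrR⟩ := exists_isAdmissible hδ1 hX
  have key : ∀ t : ℝ, (∀ i, CircleIntegrable (fun z => φ i z • resolvent X z) 0 t) →
      (∮ z in C(0, t), (∑ i ∈ s, c i * φ i z) • resolvent X z) =
        ∑ i ∈ s, c i • ∮ z in C(0, t), φ i z • resolvent X z := by
    intro t ht
    simp only [Finset.sum_smul, mul_smul]
    have := circleIntegral.integral_fun_sum (s := s) (c := 0) (R := t)
      (f := fun i z => c i • φ i z • resolvent X z) fun i _ =>
        (ht i).continuousOn_smul (g := fun _ => c i) continuousOn_const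
    rw [this]
    simp only [circleIntegral.integral_smul]
  rw [calculus_eq_contourIntegral hδ (DifferentiableOn.fun_sum fun i _ => (hφ i).const_mul _) hrR]
  simp only [calculus_eq_contourIntegral hδ (hφ _) hrR, contourIntegral]
  rw [key _ fun i => hrR.circleIntegrable_outer hδ (hφ i),
    key _ fun i => hrR.circleIntegrable_inner hδ (hφ i), ← Finset.sum_sub_distrib,
    Finset.smul_sum]
  exact Finset.sum_congr rfl fun i _ => by rw [← smul_sub, smul_comm]

theorem calculus_const_mul (hδ : 0 < δ) (hδ1 : δ < 1) (hX : spectrum ℂ X ⊆ annulus δ) (c : ℂ)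
    {φ : ℂ → ℂ} (hφ : DifferentiableOn ℂ φ (annulus δ)) :
    calculus δ (fun z => c * φ z) X = c • calculus δ φ X := by
  simpa using calculus_sum hδ hδ1 hX {()} (fun _ => c) (φ := fun _ => φ) fun _ => hφ

theorem calculus_add (hδ : 0 < δ) (hδ1 : δ < 1) (hX : spectrum ℂ X ⊆ annulus δ)
    {φ ψ : ℂ → ℂ} (hφ : DifferentiableOn ℂ φ (annulus δ)) (hψ : DifferentiableOn ℂ ψ (annulus δ)) :
    calculus δ (fun z => φ z + ψ z) X = calculus δ φ X + calculus δ ψ X := by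
  simpa using calculus_sum hδ hδ1 hX Finset.univ (fun _ : Bool => 1)
    (φ := fun b => if b then φ else ψ) (by rintro (_ | _) <;> simpa)

/-- If the bounded map `L` satisfies `z (z - X)⁻¹ = 1 + L ((z - X)⁻¹)`, then
`(z φ)(X) = L (φ(X))`. -/
theorem calculus_id_mul_aux (hδ : 0 < δ) (hδ1 : δ < 1) (hX : spectrum ℂ X ⊆ annulus δ)
    {φ : ℂ → ℂ} (hφ : DifferentiableOn ℂ φ (annulus δ))
    (L : (H →L[ℂ] H) →L[ℂ] (H →L[ℂ] H))
    (hL : ∀ z ∈ resolventSet ℂ X, z • resolvent X z = 1 + L (resolvent X z)) :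
    calculus δ (fun z => z * φ z) X = L (calculus δ φ X) := by
  obtain ⟨⟨r, R⟩, hrR⟩ := exists_isAdmissible hδ1 hX
  have hd : DifferentiableOn ℂ (fun z => z * φ z) (annulus δ) := differentiableOn_id.mul hφ
  rw [calculus_eq_contourIntegral hδ hd hrR, calculus_eq_contourIntegral hδ hφ hrR]
  obtain ⟨h1, h2, h3, h4⟩ := id hrR
  dsimp only at h1 h2 h3 h4
  have hint : ∀ t, δ < t → t < 1 → CircleIntegrable φ 0 t := fun t ht ht1 =>
    ContinuousOn.circleIntegrable (hδ.trans ht).le (hφ.continuousOn.mono fun z hz => by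
      have hz' : ‖z‖ = t := by simpa using hz
      exact ⟨hz' ▸ ht, hz' ▸ ht1⟩)
  have key : ∀ t, δ < t → t < 1 → (∀ z ∈ spectrum ℂ X, ‖z‖ ≠ t) →
      CircleIntegrable (fun z => φ z • resolvent X z) 0 t →
      (∮ z in C(0, t), (z * φ z) • resolvent X z) =
        (∮ z in C(0, t), φ z) • (1 : H →L[ℂ] H) + L (∮ z in C(0, t), φ z • resolvent X z) := by
    intro t ht ht1 hXt hi
    rw [← circleIntegral_clm_comp L hi, ← circleIntegral.integral_smul_const,
      ← circleIntegral.integral_add]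
    · refine circleIntegral.integral_congr (hδ.trans ht).le fun z hz => ?_
      have hz' : ‖z‖ = t := by simpa using hz
      have hzr : z ∈ resolventSet ℂ X := by
        by_contra hcon
        exact hXt z hcon hz'
      simp only [mul_comm z, mul_smul, hL z hzr, smul_add, L.map_smul]
    · exact (hint t ht ht1).smul_continuousOn continuousOn_const
    · exact ⟨L.integrable_comp hi.1, L.integrable_comp hi.2⟩
  -- By Cauchy's theorem the scalar terms from the two circles agree, so the multiples of the
  -- identity cancel in the difference.
  have hc : (∮ z in C(0, R), φ z) = ∮ z in C(0, r), φ z := by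
    refine Complex.circleIntegral_eq_of_differentiable_on_annulus_off_countable
      (hδ.trans h1) h2.le Set.countable_empty ?_ ?_
    · refine hφ.continuousOn.mono fun z hz => ?_
      have e1 : ‖z‖ ≤ R := by simpa using hz.1
      have e2 : r ≤ ‖z‖ := by simpa using hz.2
      exact ⟨by linarith, by linarith⟩
    · intro z hz
      have e1 : ‖z‖ < R := by simpa using hz.1.1
      have e2 : r < ‖z‖ := by simpa using hz.1.2
      have hza : z ∈ annulus δ := ⟨by linarith, by linarith⟩
      exact (hφ z hza).differentiableAt ((isOpen_annulus δ).mem_nhds hza)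
  unfold contourIntegral
  rw [key R (h1.trans h2) h3 (fun z hz => (h4 z hz).2.ne) (hrR.circleIntegrable_outer hδ hφ),
    key r h1 (h2.trans h3) (fun z hz => (h4 z hz).1.ne') (hrR.circleIntegrable_inner hδ hφ),
    hc, add_sub_add_left_eq_sub, L.map_smul, L.map_sub]

theorem calculus_id_mul (hδ : 0 < δ) (hδ1 : δ < 1) (hX : spectrum ℂ X ⊆ annulus δ)
    {φ : ℂ → ℂ} (hφ : DifferentiableOn ℂ φ (annulus δ)) :
    calculus δ (fun z => z * φ z) X = X * calculus δ φ X := by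
  refine calculus_id_mul_aux hδ hδ1 hX hφ (ContinuousLinearMap.mul ℂ _ X) fun z hz => ?_
  have := Ring.mul_inverse_cancel _ hz
  rw [sub_mul, sub_eq_iff_eq_add] at this
  rw [ContinuousLinearMap.mul_apply', resolvent, ← this, Algebra.smul_def]

theorem calculus_id_mul' (hδ : 0 < δ) (hδ1 : δ < 1) (hX : spectrum ℂ X ⊆ annulus δ)
    {φ : ℂ → ℂ} (hφ : DifferentiableOn ℂ φ (annulus δ)) :
    calculus δ (fun z => z * φ z) X = calculus δ φ X * X := by
  refine calculus_id_mul_aux hδ hδ1 hX hφ ((ContinuousLinearMap.mul ℂ _).flip X) fun z hz => ?_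
  have := Ring.inverse_mul_cancel _ hz
  rw [mul_sub, sub_eq_iff_eq_add] at this
  rw [ContinuousLinearMap.flip_apply, ContinuousLinearMap.mul_apply', resolvent, ← this,
    Algebra.smul_def, Algebra.commutes]

theorem calculus_inv_mul (hδ : 0 < δ) (hδ1 : δ < 1) (hX : spectrum ℂ X ⊆ annulus δ)
    (hu : IsUnit X) {φ : ℂ → ℂ} (hφ : DifferentiableOn ℂ φ (annulus δ)) :
    calculus δ (fun z => z⁻¹ * φ z) X = Ring.inverse X * calculus δ φ X := by
  have hd : DifferentiableOn ℂ (fun z => z⁻¹ * φ z) (annulus δ) :=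
    (differentiableOn_inv.mono fun z hz => ne_zero_of_mem_annulus hδ hz).mul hφ
  have h := calculus_id_mul hδ hδ1 hX hd
  rw [← calculus_congr hδ hδ1 hX hφ fun z hz => by
    simp [mul_inv_cancel_left₀ (ne_zero_of_mem_annulus hδ hz)]] at h
  rw [h, Ring.inverse_mul_cancel_left _ _ hu]

/-- Since `(z - X)⁻¹ - z⁻¹ = z⁻¹ X (z - X)⁻¹` is `O(|z|⁻²)`, replacing the resolvent by `z⁻¹` on a
circle of radius `t` costs only `O(1/t)`. -/
theorem tendsto_circleIntegral_resolvent (X : H →L[ℂ] H) :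
    Filter.Tendsto (fun t : ℝ => ∮ z in C(0, t), resolvent X z) Filter.atTop
      (nhds ((2 * Real.pi * Complex.I : ℂ) • (1 : H →L[ℂ] H))) := by
  obtain ⟨C, hC⟩ := (spectrum.resolvent_isBigO_inv (𝕜 := ℂ) X).bound
  rw [(Filter.atTop_basis_Ioi (α := ℝ)).cobounded_of_norm.eventually_iff] at hC
  obtain ⟨t₀, -, ht₀⟩ := hC
  rw [tendsto_iff_norm_sub_tendsto_zero]
  have hlim : Filter.Tendsto (fun t : ℝ => 2 * Real.pi * (‖X‖ * C) * t⁻¹) Filter.atTop (nhds 0) := by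
    simpa using tendsto_inv_atTop_zero.const_mul (2 * Real.pi * (‖X‖ * C))
  refine squeeze_zero' (Filter.Eventually.of_forall fun t => norm_nonneg _) ?_ hlim
  filter_upwards [Filter.eventually_gt_atTop t₀, Filter.eventually_gt_atTop 0,
    Filter.eventually_gt_atTop (‖X‖ * ‖(1 : H →L[ℂ] H)‖)] with t h1 h2 h3
  have hmem : ∀ z : ℂ, ‖z‖ = t → z ∈ resolventSet ℂ X := fun z hz =>
    spectrum.mem_resolventSet_of_norm_lt_mul (hz ▸ h3)
  have hi1 : CircleIntegrable (fun z => resolvent X z) 0 t :=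
    ContinuousOn.circleIntegrable h2.le fun z hz =>
      (spectrum.hasDerivAt_resolvent_const_left
        (hmem z (by simpa using hz))).continuousAt.continuousWithinAt
  have hi2 : CircleIntegrable (fun z : ℂ => z⁻¹ • (1 : H →L[ℂ] H)) 0 t :=
    ContinuousOn.circleIntegrable h2.le fun z hz => by
      have hz0 : z ≠ 0 := norm_pos_iff.1 (by rw [show ‖z‖ = t by simpa using hz]; exact h2)
      exact ((continuousAt_inv₀ hz0).smul continuousAt_const).continuousWithinAt
  have h0 : (2 * Real.pi * Complex.I : ℂ) • (1 : H →L[ℂ] H) =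
      ∮ z in C(0, t), z⁻¹ • (1 : H →L[ℂ] H) := by
    rw [circleIntegral.integral_smul_const]
    congr 1
    simpa using (circleIntegral.integral_sub_center_inv 0 h2.ne').symm
  rw [h0, ← circleIntegral.integral_sub hi1 hi2]
  refine (circleIntegral.norm_integral_le_of_norm_le_const h2.le
    (C := t⁻¹ * (‖X‖ * (C * t⁻¹))) fun z hz => ?_).trans_eq (by field_simp)
  have hz' : ‖z‖ = t := by simpa using hz
  have hz0 : z ≠ 0 := norm_pos_iff.1 (hz'.symm ▸ h2)
  have e := Ring.mul_inverse_cancel _ (hmem z hz')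
  rw [sub_mul, sub_eq_iff_eq_add, ← Algebra.smul_def] at e
  have e2 : resolvent X z - z⁻¹ • (1 : H →L[ℂ] H) = z⁻¹ • (X * resolvent X z) := by
    rw [sub_eq_iff_eq_add', ← smul_add, resolvent, ← e, inv_smul_smul₀ hz0]
  rw [e2, norm_smul, norm_inv, hz']
  gcongr
  refine (norm_mul_le _ _).trans ?_
  gcongr
  have := ht₀ (x := z) (by simpa [hz'] using h1)
  simpa [hz'] using this

/-- The resolvent is holomorphic on the inner disc, so the inner integral vanishes; it is also
holomorphic outside the outer circle, which can therefore be pushed to infinity. -/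
theorem calculus_one (hδ : 0 < δ) (hδ1 : δ < 1) (hX : spectrum ℂ X ⊆ annulus δ) :
    calculus δ (fun _ => 1) X = 1 := by
  obtain ⟨⟨r, R⟩, hrR⟩ := exists_isAdmissible hδ1 hX
  rw [calculus_eq_contourIntegral hδ (differentiableOn_const 1) hrR]
  obtain ⟨h1, h2, h3, h4⟩ := hrR
  dsimp only at h1 h2 h3 h4
  have hd : ∀ z : ℂ, ‖z‖ ≤ r ∨ R ≤ ‖z‖ → DifferentiableAt ℂ (resolvent X) z := fun z hz =>
    (spectrum.hasDerivAt_resolvent_const_left (by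
      by_contra hcon
      have := h4 z hcon
      rcases hz with h | h <;> linarith)).differentiableAt
  have hin : (∮ z in C(0, r), resolvent X z) = 0 := by
    refine Complex.circleIntegral_eq_zero_of_differentiable_on_off_countable
      (hδ.trans h1).le Set.countable_empty ?_ ?_
    · intro z hz
      exact (hd z (Or.inl (by simpa using hz))).continuousAt.continuousWithinAt
    · intro z hz
      have hz' : ‖z‖ < r := by simpa using hz.1
      exact hd z (Or.inl hz'.le)
  have hout : (∮ z in C(0, R), resolvent X z) = (2 * Real.pi * Complex.I : ℂ) • 1 := by
    refine tendsto_nhds_unique (Filter.Tendsto.congr' ?_ tendsto_const_nhds)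
      (tendsto_circleIntegral_resolvent X)
    filter_upwards [Filter.eventually_ge_atTop R] with t ht
    refine (Complex.circleIntegral_eq_of_differentiable_on_annulus_off_countable
      (hδ.trans (h1.trans h2)) ht Set.countable_empty ?_ ?_).symm
    · intro z hz
      exact (hd z (Or.inr (by simpa using hz.2))).continuousAt.continuousWithinAt
    · intro z hz
      have hz' : R < ‖z‖ := by simpa using hz.1.2
      exact hd z (Or.inr hz'.le)
  simp only [contourIntegral, one_smul, hin, hout, sub_zero]
  rw [inv_smul_smul₀ Complex.two_pi_I_ne_zero]

/-- Write `φ(z) = φ(l) + (z - l) ψ(z)` with `ψ` the holomorphic difference quotient. Placing the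
factor `X - l` on the right of `ψ(X)` makes it annihilate `v`. -/
theorem calculus_apply_of_apply_eq_smul (hδ : 0 < δ) (hδ1 : δ < 1)
    (hX : spectrum ℂ X ⊆ annulus δ) {φ : ℂ → ℂ} (hφ : DifferentiableOn ℂ φ (annulus δ))
    {l : ℂ} (hl : l ∈ annulus δ) {v : H} (hv : X v = l • v) :
    calculus δ φ X v = φ l • v := by
  have hψ : DifferentiableOn ℂ (dslope φ l) (annulus δ) :=
    (Complex.differentiableOn_dslope ((isOpen_annulus δ).mem_nhds hl)).2 hφ
  have e : calculus δ φ X = calculus δ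
      (fun z => z * dslope φ l z + ((-l) * dslope φ l z + φ l * 1)) X := by
    refine calculus_congr hδ hδ1 hX hφ fun z _ => ?_
    have := sub_smul_dslope φ l z
    simp only [smul_eq_mul] at this
    linear_combination -this
  have hd : DifferentiableOn ℂ (fun z => -l * dslope φ l z) (annulus δ) := hψ.const_mul _
  have hc : DifferentiableOn ℂ (fun _ => φ l * 1) (annulus δ) := differentiableOn_const _
  rw [e, calculus_add hδ hδ1 hX (φ := fun z => z * dslope φ l z) (differentiableOn_id.mul hψ)
      (hd.fun_add hc), calculus_add hδ hδ1 hX hd hc,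
    calculus_const_mul hδ hδ1 hX _ hψ, calculus_id_mul' hδ hδ1 hX hψ,
    calculus_const_mul hδ hδ1 hX _ (differentiableOn_const 1), calculus_one hδ hδ1 hX]
  simp [hv]

end Calculus

/-! ### Kernel matrices as norm inequalities -/

section KernelMatrix

variable {ι : Type*}

/-- The matrix `[(c - w̄_i w_j) g_ij]`. -/
def kernelMatrix (c : ℂ) (w : ι → ℂ) (g : Matrix ι ι ℂ) : Matrix ι ι ℂ :=
  Matrix.of fun i j => (c - conj (w i) * w j) * g i j

theorem isHermitian_kernelMatrix {c : ℝ} (w : ι → ℂ) {g : Matrix ι ι ℂ} (hg : g.IsHermitian) :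
    (kernelMatrix c w g).IsHermitian := by
  ext i j
  have := hg.apply i j
  simp only [kernelMatrix, Matrix.conjTranspose_apply, Matrix.of_apply, star_mul', star_sub,
    this]
  simp [mul_comm]

variable [Fintype ι]

theorem star_dotProduct_kernelMatrix_mulVec (c : ℂ) (w x : ι → ℂ) (g : Matrix ι ι ℂ) :
    star x ⬝ᵥ (kernelMatrix c w g).mulVec x =
      c * (star x ⬝ᵥ g.mulVec x) - star (w * x) ⬝ᵥ g.mulVec (w * x) := by
  simp only [dotProduct, Matrix.mulVec, Finset.mul_sum, ← Finset.sum_sub_distrib]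
  refine Finset.sum_congr rfl fun i _ => Finset.sum_congr rfl fun j _ => ?_
  simp only [kernelMatrix, Matrix.of_apply, Pi.star_apply, Pi.mul_apply, star_mul',
    RCLike.star_def]
  ring

open scoped MatrixOrder in
theorem exists_eq_conjTranspose_mul_self {g : Matrix ι ι ℂ} (hg : g.PosSemidef) :
    ∃ S : Matrix ι ι ℂ, g = S.conjTranspose * S := by
  classical
  exact CStarAlgebra.nonneg_iff_eq_star_mul_self.mp hg.nonneg

theorem star_dotProduct_conjTranspose_mul_self_mulVec (S : Matrix ι ι ℂ) (x : ι → ℂ) :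
    star x ⬝ᵥ (S.conjTranspose * S).mulVec x = ((‖WithLp.toLp 2 (S.mulVec x)‖ ^ 2 : ℝ) : ℂ) := by
  rw [← Matrix.mulVec_mulVec, Matrix.dotProduct_mulVec, ← Matrix.star_mulVec,
    EuclideanSpace.norm_sq_eq]
  simp [dotProduct, Complex.conj_mul']

/-- The quadratic form of the kernel matrix is `r² ‖S x‖² - ‖S (w x)‖²`. Positivity thus says that
multiplication by `w` has norm at most `r` in the seminorm `‖S x‖`. -/
theorem kernelMatrix_conjTranspose_mul_self_posSemidef_iff (r : ℝ) (w : ι → ℂ)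
    (S : Matrix ι ι ℂ) :
    (kernelMatrix ((r ^ 2 : ℝ) : ℂ) w (S.conjTranspose * S)).PosSemidef ↔
      ∀ x, ‖WithLp.toLp 2 (S.mulVec (w * x))‖ ^ 2 ≤ r ^ 2 * ‖WithLp.toLp 2 (S.mulVec x)‖ ^ 2 := by
  have key : ∀ x, star x ⬝ᵥ (kernelMatrix ((r ^ 2 : ℝ) : ℂ) w (S.conjTranspose * S)).mulVec x =
      ((r ^ 2 * ‖WithLp.toLp 2 (S.mulVec x)‖ ^ 2 -
        ‖WithLp.toLp 2 (S.mulVec (w * x))‖ ^ 2 : ℝ) : ℂ) := fun x => by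
    rw [star_dotProduct_kernelMatrix_mulVec, star_dotProduct_conjTranspose_mul_self_mulVec,
      star_dotProduct_conjTranspose_mul_self_mulVec]
    push_cast
    rfl
  rw [Matrix.posSemidef_iff_dotProduct_mulVec]
  simp only [key, Complex.zero_le_real, sub_nonneg, and_iff_right_iff_imp]
  exact fun _ => isHermitian_kernelMatrix w (Matrix.isHermitian_conjTranspose_mul_self S)

end KernelMatrix

theorem norm_calculus_le {δ : ℝ} {φ : ℂ → ℂ} {r : ℝ} (hr : 0 ≤ r)
    (h : dpNorm.{u} δ φ ≤ ENNReal.ofReal r) {H : Type u} [NormedAddCommGroup H]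
    [InnerProductSpace ℂ H] [CompleteSpace H] {X : H →L[ℂ] H} (hX : InDPFamily δ X) :
    ‖calculus δ φ X‖ ≤ r := by
  have h1 : ‖calculus δ φ X‖ₑ ≤ dpNorm.{u} δ φ := by
    rw [dpNorm]
    exact le_iSup_of_le H <| le_iSup_of_le inferInstance <| le_iSup_of_le inferInstance <|
      le_iSup_of_le inferInstance <| le_iSup_of_le X <| le_iSup_of_le hX le_rfl
  rw [← ofReal_norm] at h1
  exact (ENNReal.ofReal_le_ofReal_iff hr).1 (h1.trans h)

theorem dpNorm_le {δ : ℝ} {φ : ℂ → ℂ} {r : ℝ}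
    (h : ∀ (H : Type u) [NormedAddCommGroup H] [InnerProductSpace ℂ H] [CompleteSpace H]
      (X : H →L[ℂ] H), InDPFamily δ X → ‖calculus δ φ X‖ ≤ r) :
    dpNorm.{u} δ φ ≤ ENNReal.ofReal r := by
  refine iSup_le fun H => iSup_le fun i1 => iSup_le fun i2 => iSup_le fun i3 => iSup_le fun X =>
    iSup_le fun hX => ?_
  rw [← ofReal_norm]
  exact ENNReal.ofReal_le_ofReal (h H X hX)

/-! ### Necessity: the diagonalizable model operator of a kernel -/

section DiagonalModel

variable {ι : Type u} [Fintype ι] [DecidableEq ι]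

open Matrix in
theorem norm_toEuclideanCLM_conj_le {S : Matrix ι ι ℂ} (hS : IsUnit S) (w : ι → ℂ) {r : ℝ}
    (hr : 0 ≤ r) (h : ∀ x, ‖WithLp.toLp 2 (S *ᵥ (w * x))‖ ^ 2 ≤ r ^ 2 * ‖WithLp.toLp 2 (S *ᵥ x)‖ ^ 2) :
    ‖toEuclideanCLM (n := ι) (𝕜 := ℂ) (S * diagonal w * S⁻¹)‖ ≤ r := by
  have hS' := (Matrix.isUnit_iff_isUnit_det S).1 hS
  refine ContinuousLinearMap.opNorm_le_bound _ hr fun v => ?_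
  have h1 := h (S⁻¹ *ᵥ v.ofLp)
  rw [mulVec_mulVec, Matrix.mul_nonsing_inv _ hS', one_mulVec, ← mul_pow] at h1
  have h2 := (sq_le_sq₀ (norm_nonneg _) (by positivity)).1 h1
  have e : toEuclideanCLM (n := ι) (𝕜 := ℂ) (S * diagonal w * S⁻¹) v =
      WithLp.toLp 2 (S *ᵥ (w * S⁻¹ *ᵥ v.ofLp)) := by
    conv_lhs => rw [← WithLp.toLp_ofLp 2 v, toEuclideanCLM_toLp]
    rw [← mulVec_mulVec, ← mulVec_mulVec]
    congr 2
    ext i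
    simp [mulVec_diagonal]
  rwa [e]

open Matrix in
-- The two kernel conditions are exactly the norm bounds on `X = S diag(λ) S⁻¹` and its inverse. The
-- columns of `S` are eigenvectors of `X`, so the bound on `φ(X)` reads back as positivity. The
-- index type lies in `Type u`, so that the Euclidean space is among those over which `dpNorm.{u}`
-- takes its supremum.
theorem kernelMatrix_posSemidef_of_dpNorm_le {δ : ℝ} (hδ : 0 < δ) (hδ1 : δ < 1) {lam : ι → ℂ}
    (hlam : ∀ j, lam j ∈ annulus δ) {g : Matrix ι ι ℂ} (hg : g.PosDef)
    (h1 : (kernelMatrix 1 lam g).PosSemidef)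
    (h2 : (kernelMatrix 1 (fun j => δ / lam j) g).PosSemidef) {φ : ℂ → ℂ}
    (hφ : DifferentiableOn ℂ φ (annulus δ)) {r : ℝ} (hr : 0 ≤ r)
    (hφr : dpNorm.{u} δ φ ≤ ENNReal.ofReal r) :
    (kernelMatrix ((r ^ 2 : ℝ) : ℂ) (fun j => φ (lam j)) g).PosSemidef := by
  have hl0 : ∀ j, lam j ≠ 0 := fun j => ne_zero_of_mem_annulus hδ (hlam j)
  obtain ⟨S, hSu, rfl⟩ : ∃ S : Matrix ι ι ℂ, IsUnit S ∧ g = Sᴴ * S := by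
    obtain ⟨S, hS⟩ := exists_eq_conjTranspose_mul_self hg.posSemidef
    refine ⟨S, ?_, hS⟩
    have := hg.isUnit
    rw [hS] at this
    exact isUnit_of_mul_isUnit_right this
  have hSd := (Matrix.isUnit_iff_isUnit_det S).1 hSu
  have e1 : (1 : ℂ) = ((1 ^ 2 : ℝ) : ℂ) := by simp
  rw [e1, kernelMatrix_conjTranspose_mul_self_posSemidef_iff] at h1 h2
  set A := toEuclideanCLM (n := ι) (𝕜 := ℂ)
  have hX1 := norm_toEuclideanCLM_conj_le hSu lam zero_le_one h1
  have hX2 : ‖A (S * diagonal (fun j => (lam j)⁻¹) * S⁻¹)‖ ≤ 1 / δ := by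
    refine norm_toEuclideanCLM_conj_le hSu _ (by positivity) fun x => ?_
    have := h2 x
    have e : (fun j => (δ : ℂ) / lam j) * x = (δ : ℂ) • ((fun j => (lam j)⁻¹) * x) := by
      ext j
      simp [div_eq_mul_inv, mul_assoc]
    rw [e, mulVec_smul, WithLp.toLp_smul, norm_smul, Complex.norm_real, Real.norm_of_nonneg hδ.le,
      mul_pow, one_pow, one_mul] at this
    rw [one_div, inv_pow, ← div_eq_inv_mul, le_div_iff₀' (by positivity)]
    exact this
  set X := A (S * diagonal lam * S⁻¹)
  have hXY : ∀ w w' : ι → ℂ, (∀ j, w j * w' j = 1) →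
      A (S * diagonal w * S⁻¹) * A (S * diagonal w' * S⁻¹) = 1 := fun w w' hw => by
    rw [← map_mul]
    have : S * diagonal w * S⁻¹ * (S * diagonal w' * S⁻¹) =
        S * (diagonal w * ((S⁻¹ * S) * diagonal w')) * S⁻¹ := by
      simp only [Matrix.mul_assoc]
    rw [this, Matrix.nonsing_inv_mul _ hSd, Matrix.one_mul, diagonal_mul_diagonal]
    simp [hw, Matrix.mul_nonsing_inv _ hSd]
  let U : (EuclideanSpace ℂ ι →L[ℂ] EuclideanSpace ℂ ι)ˣ :=
    ⟨X, A (S * diagonal (fun j => (lam j)⁻¹) * S⁻¹), hXY _ _ fun j => mul_inv_cancel₀ (hl0 j),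
      hXY _ _ fun j => inv_mul_cancel₀ (hl0 j)⟩
  have hinv : Ring.inverse X = A (S * diagonal (fun j => (lam j)⁻¹) * S⁻¹) :=
    Ring.inverse_unit U
  have hspec : spectrum ℂ X ⊆ annulus δ := by
    have : spectrum ℂ X = Set.range lam := by
      rw [AlgEquiv.spectrum_eq A, ← spectrum_diagonal lam]
      have hS1 : S⁻¹ = ((hSu.unit⁻¹ : (Matrix ι ι ℂ)ˣ) : Matrix ι ι ℂ) := by
        rw [Matrix.coe_units_inv, hSu.unit_spec]
      have := spectrum.units_conjugate (R := ℂ) (a := diagonal lam) (u := hSu.unit)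
      rw [← this, hS1, hSu.unit_spec]
    rw [this]
    rintro _ ⟨j, rfl⟩
    exact hlam j
  have hX : InDPFamily δ X := ⟨⟨U.isUnit, hX1, hinv ▸ hX2⟩, hspec⟩
  have hn := norm_calculus_le hr hφr hX
  rw [kernelMatrix_conjTranspose_mul_self_posSemidef_iff]
  intro x
  have hev : ∀ j, X (WithLp.toLp 2 (S *ᵥ Pi.single j 1)) =
      lam j • WithLp.toLp 2 (S *ᵥ Pi.single j 1) := fun j => by
    rw [toEuclideanCLM_toLp, ← mulVec_mulVec, ← mulVec_mulVec, mulVec_mulVec _ S⁻¹,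
      Matrix.nonsing_inv_mul _ hSd, one_mulVec, diagonal_mulVec_single, ← WithLp.toLp_smul,
      ← mulVec_smul]
    congr 2
    ext i
    simp [Pi.single_apply]
  have hx : ∀ y : ι → ℂ, WithLp.toLp 2 (S *ᵥ y) =
      ∑ j, y j • WithLp.toLp 2 (S *ᵥ Pi.single j 1) := fun y => by
    simp only [← WithLp.toLp_smul, ← mulVec_smul, ← WithLp.toLp_sum, ← mulVec_sum]
    congr 2
    ext i
    simp [Pi.single_apply]
  have hφx : calculus δ φ X (WithLp.toLp 2 (S *ᵥ x)) =
      WithLp.toLp 2 (S *ᵥ ((fun j => φ (lam j)) * x)) := by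
    rw [hx x, hx, map_sum]
    refine Finset.sum_congr rfl fun j _ => ?_
    rw [map_smul, calculus_apply_of_apply_eq_smul hδ hδ1 hspec hφ (hlam j) (hev j), smul_smul,
      mul_comm, Pi.mul_apply]
  rw [← hφx, ← mul_pow]
  gcongr
  exact (ContinuousLinearMap.le_opNorm _ _).trans (by gcongr)

end DiagonalModel

theorem pickMatrix_eq_kernelMatrix {n : ℕ} (w : Fin n → ℂ) (g : Matrix (Fin n) (Fin n) ℂ) :
    pickMatrix w g = kernelMatrix 1 w g := rfl

theorem mem_dpKernels_iff {δ : ℝ} {n : ℕ} {lam : Fin n → ℂ} {g : Matrix (Fin n) (Fin n) ℂ} :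
    g ∈ dpKernels δ lam ↔ g.PosDef ∧ (kernelMatrix 1 lam g).PosSemidef ∧
      (kernelMatrix 1 (fun j => δ / lam j) g).PosSemidef := by
  simp [dpKernels, pickMatrix, kernelMatrix]

theorem kernelMatrix_posSemidef_of_mem_dpKernels {δ : ℝ} (hδ : 0 < δ) (hδ1 : δ < 1) {n : ℕ}
    {lam : Fin n → ℂ} (hlam : ∀ j, lam j ∈ annulus δ) {g : Matrix (Fin n) (Fin n) ℂ}
    (hg : g ∈ dpKernels δ lam) {φ : ℂ → ℂ} (hφ : DifferentiableOn ℂ φ (annulus δ)) {r : ℝ}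
    (hr : 0 ≤ r) (hφr : dpNorm.{u} δ φ ≤ ENNReal.ofReal r) :
    (kernelMatrix ((r ^ 2 : ℝ) : ℂ) (fun j => φ (lam j)) g).PosSemidef := by
  rw [mem_dpKernels_iff] at hg
  obtain ⟨h0, h1, h2⟩ := hg
  -- Lifting the index set places the model space in the universe of the dp-norm; reindexing
  -- preserves all the positivity conditions.
  have e : Function.Injective (Equiv.ulift.{u} : ULift (Fin n) ≃ Fin n) := Equiv.injective _
  have := kernelMatrix_posSemidef_of_dpNorm_le hδ hδ1
    (lam := fun j : ULift.{u} (Fin n) => lam (Equiv.ulift j))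
    (fun j => hlam _) (h0.submatrix e) (h1.submatrix _) (h2.submatrix _) hφ hr hφr
  exact (Matrix.posSemidef_submatrix_equiv Equiv.ulift.{u}).1 this

/-! ### Sufficiency: lurking isometry and transfer function -/

open Matrix

/-- The isometry `U` remains isometric after tensoring with `H`. This is what allows a scalar matrix
to act on tuples of vectors `f_j(X) v`. -/
theorem sum_norm_sq_of_conjTranspose_mul_self_eq_one {ι : Type*} [Fintype ι] [DecidableEq ι]
    {U : Matrix ι ι ℂ} (hU : Uᴴ * U = 1) {H : Type*} [NormedAddCommGroup H]
    [InnerProductSpace ℂ H] (h : ι → H) :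
    ∑ i, ‖∑ j, U i j • h j‖ ^ 2 = ∑ j, ‖h j‖ ^ 2 := by
  have key : (∑ i, ((‖∑ j, U i j • h j‖ ^ 2 : ℝ) : ℂ)) = ∑ j, ((‖h j‖ ^ 2 : ℝ) : ℂ) := by
    have e : ∀ j k, (∑ i, conj (U i j) * U i k) = (1 : Matrix ι ι ℂ) j k := fun j k => by
      rw [← hU]
      simp [Matrix.mul_apply]
    calc (∑ i, ((‖∑ j, U i j • h j‖ ^ 2 : ℝ) : ℂ))
        = ∑ i, ∑ j, ∑ k, (conj (U i j) * U i k) * inner ℂ (h j) (h k) := by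
          refine Finset.sum_congr rfl fun i _ => ?_
          push_cast
          rw [← RCLike.ofReal_eq_complex_ofReal, ← inner_self_eq_norm_sq_to_K, sum_inner]
          refine Finset.sum_congr rfl fun j _ => ?_
          rw [inner_sum]
          refine Finset.sum_congr rfl fun k _ => ?_
          rw [inner_smul_left, inner_smul_right]
          ring
      _ = ∑ j, ∑ k, (1 : Matrix ι ι ℂ) j k * inner ℂ (h j) (h k) := by
          rw [Finset.sum_comm]
          refine Finset.sum_congr rfl fun j _ => ?_
          rw [Finset.sum_comm]
          refine Finset.sum_congr rfl fun k _ => ?_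
          rw [← e, Finset.sum_mul]
      _ = ∑ j, ((‖h j‖ ^ 2 : ℝ) : ℂ) := by
          refine Finset.sum_congr rfl fun j _ => ?_
          simp only [Matrix.one_apply, ite_mul, one_mul, zero_mul, Finset.sum_ite_eq,
            Finset.mem_univ, if_true]
          rw [inner_self_eq_norm_sq_to_K]
          push_cast
          rfl
  exact_mod_cast key

/-- Equality of the Gram matrices makes `∑ c_j p_j ↦ ∑ c_j q_j` a well-defined isometry on the span
of the `p_j`; in finite dimension it extends to the whole space. -/
theorem exists_conjTranspose_mul_self_eq_one_mulVec_eq {ι κ : Type*} [Fintype ι] [DecidableEq ι]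
    [Fintype κ] {p q : κ → ι → ℂ} (h : ∀ i j, star (p i) ⬝ᵥ p j = star (q i) ⬝ᵥ q j) :
    ∃ U : Matrix ι ι ℂ, Uᴴ * U = 1 ∧ ∀ j, U *ᵥ p j = q j := by
  classical
  let P : (κ → ℂ) →ₗ[ℂ] EuclideanSpace ℂ ι :=
    Fintype.linearCombination ℂ fun j => WithLp.toLp 2 (p j)
  let Q : (κ → ℂ) →ₗ[ℂ] EuclideanSpace ℂ ι :=
    Fintype.linearCombination ℂ fun j => WithLp.toLp 2 (q j)
  have hPQ : ∀ c, ‖P c‖ = ‖Q c‖ := fun c => by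
    have : (inner ℂ (P c) (P c) : ℂ) = inner ℂ (Q c) (Q c) := by
      simp only [P, Q, Fintype.linearCombination_apply, sum_inner, inner_sum, inner_smul_left,
        inner_smul_right, EuclideanSpace.inner_toLp_toLp, dotProduct_comm _ (star _), h]
    rw [inner_self_eq_norm_sq_to_K, inner_self_eq_norm_sq_to_K] at this
    have h2 : ‖P c‖ ^ 2 = ‖Q c‖ ^ 2 := by exact_mod_cast this
    exact (pow_left_inj₀ (norm_nonneg _) (norm_nonneg _) two_ne_zero).1 h2
  -- The section `s` chooses coefficients linearly; the choice is harmless because `P` and `Q` have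
  -- the same kernel.
  obtain ⟨s, hs⟩ := LinearMap.exists_rightInverse_of_surjective P.rangeRestrict
    (LinearMap.range_rangeRestrict P)
  have hs' : ∀ y, P (s y) = y := fun y => congrArg Subtype.val (LinearMap.congr_fun hs y)
  let L : LinearMap.range P →ₗᵢ[ℂ] EuclideanSpace ℂ ι :=
    ⟨Q ∘ₗ s, fun y => by
      rw [LinearMap.comp_apply, ← hPQ, hs']
      rfl⟩
  have hL : ∀ c, L.extend (P c) = Q c := fun c => by
    have h1 := L.extend_apply ⟨P c, LinearMap.mem_range_self P c⟩
    rw [h1]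
    change Q (s _) = Q c
    rw [← sub_eq_zero, ← map_sub, ← norm_eq_zero, ← hPQ, map_sub, hs', sub_self, norm_zero]
  refine ⟨of fun i j => L.extend (EuclideanSpace.single j 1) i, ?_, fun j => ?_⟩
  · ext i j
    have h1 := L.extend.inner_map_map (EuclideanSpace.single i 1) (EuclideanSpace.single j 1)
    rw [EuclideanSpace.inner_eq_star_dotProduct, EuclideanSpace.inner_single_left] at h1
    simp only [map_one, one_mul, PiLp.single_apply] at h1
    rw [one_apply, ← h1, dotProduct_comm]
    rfl
  · have e1 : P (Pi.single j 1) = WithLp.toLp 2 (p j) := by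
      simp [P, Fintype.linearCombination_apply_single]
    have e2 : Q (Pi.single j 1) = WithLp.toLp 2 (q j) := by
      simp [Q, Fintype.linearCombination_apply_single]
    have h1 := hL (Pi.single j 1)
    have e3 : WithLp.toLp 2 (p j) = ∑ i, p j i • EuclideanSpace.single i (1 : ℂ) := by
      ext k
      simp [Pi.single_apply]
    rw [e1, e2, e3, map_sum] at h1
    ext k
    have h2 := congrArg (fun v : EuclideanSpace ℂ ι => v k) h1
    simp only [map_smul, WithLp.ofLp_sum, Finset.sum_apply, PiLp.smul_apply, smul_eq_mul] at h2
    rw [← h2]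
    simp [mulVec, dotProduct, mul_comm]

theorem differentiableAt_matrix_det {κ : Type*} [Fintype κ] [DecidableEq κ]
    {M : ℂ → Matrix κ κ ℂ} {z : ℂ} (hM : ∀ i j, DifferentiableAt ℂ (fun z => M z i j) z) :
    DifferentiableAt ℂ (fun z => (M z).det) z := by
  simp only [det_apply]
  refine DifferentiableAt.fun_sum fun σ _ => DifferentiableAt.fun_const_smul ?_ _
  exact DifferentiableAt.fun_finsetProd fun i _ => hM _ _

theorem differentiableAt_matrix_inv {κ : Type*} [Fintype κ] [DecidableEq κ]
    {M : ℂ → Matrix κ κ ℂ} {z : ℂ} (hM : ∀ i j, DifferentiableAt ℂ (fun z => M z i j) z)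
    (hz : (M z).det ≠ 0) (i j : κ) : DifferentiableAt ℂ (fun z => (M z)⁻¹ i j) z := by
  simp only [inv_def, Ring.inverse_eq_inv', Matrix.smul_apply, smul_eq_mul, adjugate_apply]
  refine ((differentiableAt_matrix_det hM).fun_inv hz).fun_mul
    (differentiableAt_matrix_det fun k l => ?_)
  simp only [updateRow_apply]
  split_ifs
  · exact differentiableAt_const _
  · exact hM _ _

section Realization

variable {κ : Type*} [Fintype κ] [DecidableEq κ]

/-- The matrix-vector relation defining a realization: `U (1, e x) = (w, x)`. -/
def IsRealizedBy (U : Matrix (Option κ) (Option κ) ℂ) (e x : κ → ℂ) (w : ℂ) : Prop :=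
  U *ᵥ (fun i => i.elim 1 (e * x)) = fun i => i.elim w x

/-- A null vector `x` would satisfy `U (0, e x) = (*, x)`, whence `‖x‖ ≤ ‖e x‖ < ‖x‖`. -/
theorem det_one_sub_mul_diagonal_ne_zero {U : Matrix (Option κ) (Option κ) ℂ} (hU : Uᴴ * U = 1)
    {e : κ → ℂ} (he : ∀ k, ‖e k‖ < 1) :
    (1 - U.submatrix some some * diagonal e).det ≠ 0 := by
  intro hdet
  obtain ⟨x, hx0, hx⟩ := exists_mulVec_eq_zero_iff.2 hdet
  rw [sub_mulVec, one_mulVec, sub_eq_zero] at hx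
  have h1 := sum_norm_sq_of_conjTranspose_mul_self_eq_one hU
    (fun i : Option κ => i.elim 0 (e * x))
  have h2 : ∀ k, ∑ j : Option κ, U (some k) j • (j.elim 0 (e * x) : ℂ) = x k := fun k => by
    conv_rhs => rw [hx, ← mulVec_mulVec]
    simp [Fintype.sum_option, mulVec, dotProduct, diagonal_apply]
  simp only [Fintype.sum_option (f := fun i => ‖∑ j : Option κ, U i j • (j.elim 0 (e * x) : ℂ)‖ ^ 2),
    h2] at h1
  simp only [Fintype.sum_option, Option.elim] at h1
  obtain ⟨k, hk⟩ := Function.ne_iff.1 hx0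
  have h3 : ∑ k, ‖(e * x) k‖ ^ 2 < ∑ k, ‖x k‖ ^ 2 := by
    refine Finset.sum_lt_sum (fun i _ => ?_) ⟨k, Finset.mem_univ _, ?_⟩
    · rw [Pi.mul_apply, norm_mul]
      gcongr
      exact mul_le_of_le_one_left (norm_nonneg _) (he i).le
    · rw [Pi.mul_apply, norm_mul]
      gcongr
      exact mul_lt_of_lt_one_left (norm_pos_iff.2 hk) (he k)
  have h4 : 0 ≤ ‖U none none • (0 : ℂ) + ∑ j, U none (some j) • (e * x) j‖ ^ 2 := by positivity
  rw [norm_zero] at h1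
  linarith

/-- The lower rows of the relation are the linear system `(1 - D e) a = c`, where `D` is the lower
right block of `U` and `c` the rest of its first column. Its unique solution is holomorphic by
Cramer's rule, and the top row then defines `φ`. -/
theorem exists_isRealizedBy {U : Matrix (Option κ) (Option κ) ℂ} (hU : Uᴴ * U = 1) {Ω : Set ℂ}
    (hΩ : IsOpen Ω) {e : κ → ℂ → ℂ} (he : ∀ k, DifferentiableOn ℂ (e k) Ω)
    (he1 : ∀ k, ∀ z ∈ Ω, ‖e k z‖ < 1) :
    ∃ (φ : ℂ → ℂ) (a : κ → ℂ → ℂ), DifferentiableOn ℂ φ Ω ∧ (∀ k, DifferentiableOn ℂ (a k) Ω) ∧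
      (∀ z ∈ Ω, IsRealizedBy U (e · z) (a · z) (φ z)) ∧
      ∀ z ∈ Ω, ∀ x w, IsRealizedBy U (e · z) x w → φ z = w := by
  let M : ℂ → Matrix κ κ ℂ := fun z => 1 - U.submatrix some some * diagonal (e · z)
  let c : κ → ℂ := fun k => U (some k) none
  let a : κ → ℂ → ℂ := fun k z => ((M z)⁻¹ *ᵥ c) k
  let φ : ℂ → ℂ := fun z => U none none + ∑ k, U none (some k) * (e k z * a k z)
  have hdet : ∀ z ∈ Ω, (M z).det ≠ 0 := fun z hz =>
    det_one_sub_mul_diagonal_ne_zero hU fun k => he1 k z hz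
  have hMd : ∀ z ∈ Ω, ∀ i j, DifferentiableAt ℂ (fun z => M z i j) z := fun z hz i j => by
    simp only [M, Matrix.sub_apply, mul_diagonal]
    exact (differentiableAt_const _).sub
      (((he j z hz).differentiableAt (hΩ.mem_nhds hz)).const_mul _)
  have ha : ∀ k, DifferentiableOn ℂ (a k) Ω := fun k z hz => by
    refine DifferentiableAt.differentiableWithinAt ?_
    simp only [a, mulVec, dotProduct]
    exact DifferentiableAt.fun_sum fun j _ =>
      (differentiableAt_matrix_inv (hMd z hz) (hdet z hz) k j).mul_const _
  have hφ : DifferentiableOn ℂ φ Ω := (differentiableOn_const _).add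
    (DifferentiableOn.fun_sum fun k _ => ((he k).mul (ha k)).const_mul _)
  have hfix : ∀ (z : ℂ) (x : κ → ℂ) (k : κ),
      (U *ᵥ (fun i => i.elim 1 ((e · z) * x))) (some k) = (c + (x - M z *ᵥ x)) k := fun z x k => by
    simp only [M, sub_mulVec, one_mulVec, ← mulVec_mulVec, sub_sub_cancel]
    simp [mulVec, dotProduct, Fintype.sum_option, c, mul_assoc]
  have hnone : ∀ (z : ℂ) (x : κ → ℂ), (U *ᵥ (fun i => i.elim 1 ((e · z) * x))) none =
      U none none + ∑ k, U none (some k) * (e k z * x k) := fun z x => by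
    simp [mulVec, dotProduct, Fintype.sum_option]
  refine ⟨φ, a, hφ, ha, fun z hz => ?_, fun z hz x w hx => ?_⟩
  · ext (_ | k)
    · exact hnone z _
    · rw [hfix]
      have : M z *ᵥ (a · z) = c := by
        change M z *ᵥ ((M z)⁻¹ *ᵥ c) = c
        rw [mulVec_mulVec, mul_nonsing_inv _ (Ne.isUnit (hdet z hz)), one_mulVec]
      rw [this]
      simp
  · have hxa : x = (a · z) := by
      have h1 : M z *ᵥ x = c := by
        ext k
        have := congrFun hx (some k)
        rw [hfix] at this
        simp only [Pi.add_apply, Pi.sub_apply, Option.elim] at this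
        linear_combination -this
      change x = (M z)⁻¹ *ᵥ c
      rw [← h1, mulVec_mulVec, nonsing_inv_mul _ (Ne.isUnit (hdet z hz)), one_mulVec]
    have := congrFun hx none
    rw [hnone, hxa] at this
    exact this

/-- Applying the calculus to the realization gives `‖φ(X)v‖² + ∑ ‖a_k(X)v‖² = ‖v‖² + ∑ ‖e_k(X)
a_k(X)v‖²`. Each `e_k(X)` is `X` or `δ X⁻¹`, a contraction, so the sums can be cancelled. -/
theorem norm_calculus_le_one_of_isRealizedBy {δ : ℝ} (hδ : 0 < δ) (hδ1 : δ < 1)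
    {U : Matrix (Option κ) (Option κ) ℂ} (hU : Uᴴ * U = 1) {e : κ → ℂ → ℂ}
    (he : ∀ k, e k = (fun z => z) ∨ e k = fun z : ℂ => (δ : ℂ) / z) {φ : ℂ → ℂ} {a : κ → ℂ → ℂ}
    (hφ : DifferentiableOn ℂ φ (annulus δ)) (ha : ∀ k, DifferentiableOn ℂ (a k) (annulus δ))
    (h : ∀ z ∈ annulus δ, IsRealizedBy U (e · z) (a · z) (φ z))
    {H : Type u} [NormedAddCommGroup H] [InnerProductSpace ℂ H] [CompleteSpace H]
    {X : H →L[ℂ] H} (hX : InDPFamily δ X) : ‖calculus δ φ X‖ ≤ 1 := by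
  obtain ⟨⟨hu, hX1, hX2⟩, hs⟩ := hX
  have hinvd : DifferentiableOn ℂ (fun z : ℂ => z⁻¹) (annulus δ) :=
    differentiableOn_inv.mono fun z hz => ne_zero_of_mem_annulus hδ hz
  have hed : ∀ k, DifferentiableOn ℂ (e k) (annulus δ) := fun k => by
    rcases he k with h | h
    · rw [h]
      exact differentiableOn_id
    · simp only [h, div_eq_mul_inv]
      exact hinvd.const_mul _
  have hT : ∀ k, ∃ T : H →L[ℂ] H, ‖T‖ ≤ 1 ∧
      calculus δ (fun z => e k z * a k z) X = T * calculus δ (a k) X := fun k => by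
    rcases he k with h | h
    · exact ⟨X, hX1, by simpa only [h] using calculus_id_mul hδ hδ1 hs (ha k)⟩
    · refine ⟨(δ : ℂ) • Ring.inverse X, ?_, ?_⟩
      · rw [norm_smul, Complex.norm_real, Real.norm_of_nonneg hδ.le]
        calc δ * ‖Ring.inverse X‖ ≤ δ * (1 / δ) := by gcongr
          _ = 1 := by field_simp
      · simp only [h, div_eq_mul_inv, mul_assoc]
        rw [calculus_const_mul hδ hδ1 hs _ (hinvd.fun_mul (ha k)), calculus_inv_mul hδ hδ1 hs hu (ha k),
          smul_mul_assoc]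
  choose T hT1 hT2 using hT
  let f : Option κ → ℂ → ℂ := fun i => i.elim (fun _ => 1) fun k z => e k z * a k z
  let F : Option κ → ℂ → ℂ := fun i => i.elim φ a
  have hf : ∀ i, DifferentiableOn ℂ (f i) (annulus δ) := by
    rintro (_ | k)
    · exact differentiableOn_const _
    · exact (hed k).mul (ha k)
  have hF : ∀ i, DifferentiableOn ℂ (F i) (annulus δ) := by
    rintro (_ | k)
    · exact hφ
    · exact ha k
  have hFf : ∀ i, calculus δ (F i) X = ∑ j, U i j • calculus δ (f j) X := fun i => by
    rw [← calculus_sum hδ hδ1 hs Finset.univ (U i) hf]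
    refine calculus_congr hδ hδ1 hs (hF i) fun z hz => ?_
    have := congrFun (h z hz) i
    have e1 : F i z = i.elim (φ z) (a · z) := by cases i <;> rfl
    rw [e1, ← this]
    simp only [mulVec, dotProduct]
    refine Finset.sum_congr rfl fun j _ => ?_
    cases j <;> rfl
  refine ContinuousLinearMap.opNorm_le_bound _ zero_le_one fun v => ?_
  have key := sum_norm_sq_of_conjTranspose_mul_self_eq_one hU fun j => calculus δ (f j) X v
  have e2 : ∀ i, ∑ j, U i j • calculus δ (f j) X v = calculus δ (F i) X v := fun i => by
    rw [hFf]
    simp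
  simp only [e2] at key
  rw [Fintype.sum_option, Fintype.sum_option] at key
  have h0 : calculus δ (f none) X v = v := by
    rw [show f none = fun _ => 1 from rfl, calculus_one hδ hδ1 hs]
    rfl
  have hle : ∑ k, ‖calculus δ (f (some k)) X v‖ ^ 2 ≤ ∑ k, ‖calculus δ (F (some k)) X v‖ ^ 2 := by
    refine Finset.sum_le_sum fun k _ => ?_
    gcongr
    change ‖calculus δ (fun z => e k z * a k z) X v‖ ≤ ‖calculus δ (a k) X v‖
    rw [hT2]
    exact ((T k).le_opNorm _).trans (mul_le_of_le_one_left (norm_nonneg _) (hT1 k))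
  rw [h0] at key
  rw [one_mul]
  refine (sq_le_sq₀ (norm_nonneg _) (norm_nonneg _)).1 ?_
  change ‖calculus δ (F none) X v‖ ^ 2 ≤ _
  linarith

end Realization

/-- A decomposition `1 - z̄_i z_j = (1 - λ̄_i λ_j) A_ij + (1 - (δ/λ̄_i) (δ/λ_j)) B_ij` with positive
semidefinite `A` and `B` yields a solution of the interpolation problem. -/
theorem solvable_of_eq_kernelMatrix_add {δ : ℝ} (hδ : 0 < δ) (hδ1 : δ < 1) {n : ℕ}
    {lam z : Fin n → ℂ} (hlam : ∀ j, lam j ∈ annulus δ) {A B : Matrix (Fin n) (Fin n) ℂ}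
    (hA : A.PosSemidef) (hB : B.PosSemidef)
    (h : kernelMatrix 1 z (Matrix.of fun _ _ => 1) =
      kernelMatrix 1 lam A + kernelMatrix 1 (fun j => δ / lam j) B) :
    Solvable.{u} δ lam z := by
  obtain ⟨S, rfl⟩ := exists_eq_conjTranspose_mul_self hA
  obtain ⟨T, rfl⟩ := exists_eq_conjTranspose_mul_self hB
  let κ := Fin n ⊕ Fin n
  let e : κ → ℂ → ℂ := Sum.elim (fun _ z => z) fun _ z => δ / z
  let x : Fin n → κ → ℂ := fun j => Sum.elim (fun k => S k j) fun k => T k j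
  have he : ∀ k, e k = (fun z => z) ∨ e k = fun z : ℂ => (δ : ℂ) / z := by
    rintro (k | k)
    · exact Or.inl rfl
    · exact Or.inr rfl
  have hed : ∀ k, DifferentiableOn ℂ (e k) (annulus δ) := by
    rintro (k | k)
    · exact differentiableOn_id
    · exact (differentiableOn_const _).div differentiableOn_id
        fun z hz => ne_zero_of_mem_annulus hδ hz
  have he1 : ∀ k, ∀ z ∈ annulus δ, ‖e k z‖ < 1 := by
    rintro (k | k) z hz
    · exact hz.2
    · change ‖(δ : ℂ) / z‖ < 1
      rw [norm_div, Complex.norm_real, Real.norm_of_nonneg hδ.le, div_lt_one (hδ.trans hz.1)]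
      exact hz.1
  -- With `x_j` the stacked `j`-th columns of the two factors, moving the negative terms across
  -- turns the decomposition into equality of the Gram matrices of `(1, e(λ_j) x_j)` and `(z_j,
  -- x_j)`.
  obtain ⟨U, hU, hUp⟩ := exists_conjTranspose_mul_self_eq_one_mulVec_eq
    (p := fun j (i : Option κ) => i.elim 1 ((e · (lam j)) * x j))
    (q := fun j (i : Option κ) => i.elim (z j) (x j)) fun i j => by
      have := congrFun (congrFun h i) j
      simp only [kernelMatrix, of_apply, mul_one, Matrix.add_apply, mul_apply, conjTranspose_apply,
        RCLike.star_def] at this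
      simp only [dotProduct, Fintype.sum_option, Pi.star_apply, Option.elim, star_one, mul_one,
        κ, Fintype.sum_sum_type, Pi.mul_apply, e, x, Sum.elim_inl, Sum.elim_inr, star_mul']
      have s1 : ∑ k, star (lam i) * star (S k i) * (lam j * S k j) =
          conj (lam i) * lam j * ∑ k, conj (S k i) * S k j := by
        rw [Finset.mul_sum]
        exact Finset.sum_congr rfl fun k _ => by rw [← RCLike.star_def]; ring
      have s2 : ∑ k, star (δ / lam i) * star (T k i) * (δ / lam j * T k j) =
          conj (δ / lam i) * (δ / lam j) * ∑ k, conj (T k i) * T k j := by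
        rw [Finset.mul_sum]
        exact Finset.sum_congr rfl fun k _ => by rw [← RCLike.star_def]; ring
      rw [s1, s2, RCLike.star_def]
      linear_combination this
  obtain ⟨φ, a, hφ, ha, hr, huniq⟩ := exists_isRealizedBy hU (isOpen_annulus δ) hed he1
  refine ⟨φ, ⟨hφ, ?_⟩, fun j => huniq _ (hlam j) _ _ (hUp j)⟩
  have := dpNorm_le (δ := δ) (φ := φ) (r := 1) fun H _ _ _ X hX =>
    norm_calculus_le_one_of_isRealizedBy hδ hδ1 hU he hφ ha hr hX
  simpa using this

open Topology

/-! ### The cone of decompositions and its dual -/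

section Cone

open scoped Matrix.Norms.Elementwise

variable {ι : Type*}

theorem kernelMatrix_add (c : ℂ) (w : ι → ℂ) (g h : Matrix ι ι ℂ) :
    kernelMatrix c w (g + h) = kernelMatrix c w g + kernelMatrix c w h := by
  ext i j
  simp [kernelMatrix, mul_add]

theorem kernelMatrix_smul (c : ℂ) (w : ι → ℂ) (t : ℝ) (g : Matrix ι ι ℂ) :
    kernelMatrix c w (t • g) = t • kernelMatrix c w g := by
  ext i j
  simp [kernelMatrix]
  ring

theorem continuous_kernelMatrix (c : ℂ) (w : ι → ℂ) :
    Continuous (kernelMatrix (ι := ι) c w) :=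
  continuous_pi fun i => continuous_pi fun j =>
    continuous_const.mul ((continuous_apply j).comp (continuous_apply i))

/-- The cone of all `[(1 - ā_i a_j) A_ij + (1 - b̄_i b_j) B_ij]` with positive semidefinite `A`
and `B`. -/
def modelCone (a b : ι → ℂ) : Set (Matrix ι ι ℂ) :=
  {M | ∃ A B : Matrix ι ι ℂ, A.PosSemidef ∧ B.PosSemidef ∧
    M = kernelMatrix 1 a A + kernelMatrix 1 b B}

theorem smul_mem_modelCone {a b : ι → ℂ} {M : Matrix ι ι ℂ} (hM : M ∈ modelCone a b) {t : ℝ}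
    (ht : 0 ≤ t) : t • M ∈ modelCone a b := by
  obtain ⟨A, B, hA, hB, rfl⟩ := hM
  exact ⟨t • A, t • B, hA.smul ht, hB.smul ht, by
    rw [kernelMatrix_smul, kernelMatrix_smul, smul_add]⟩

theorem convex_modelCone (a b : ι → ℂ) : Convex ℝ (modelCone a b) := by
  rintro M hM N hN s t hs ht -
  obtain ⟨A, B, hA, hB, e1⟩ := smul_mem_modelCone hM hs
  obtain ⟨A', B', hA', hB', e2⟩ := smul_mem_modelCone hN ht
  refine ⟨A + A', B + B', hA.add hA', hB.add hB', ?_⟩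
  rw [e1, e2, kernelMatrix_add, kernelMatrix_add]
  abel

theorem kernelMatrix_one_apply_self_re (a : ι → ℂ) (A : Matrix ι ι ℂ) (i : ι) :
    (kernelMatrix 1 a A i i).re = (1 - ‖a i‖ ^ 2) * (A i i).re := by
  have : (1 : ℂ) - conj (a i) * a i = ((1 - ‖a i‖ ^ 2 : ℝ) : ℂ) := by
    rw [Complex.conj_mul']
    push_cast
    rfl
  rw [kernelMatrix, of_apply, this, Complex.re_ofReal_mul]

variable [Fintype ι]

theorem norm_apply_le_re_trace {A : Matrix ι ι ℂ} (hA : A.PosSemidef) (i j : ι) :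
    ‖A i j‖ ≤ A.trace.re := by
  obtain ⟨S, rfl⟩ := exists_eq_conjTranspose_mul_self hA
  have e : (Sᴴ * S).trace.re = ∑ k, ∑ l, ‖S k l‖ ^ 2 := by
    rw [Finset.sum_comm]
    simp [trace, mul_apply, Complex.conj_mul', ← Complex.ofReal_pow]
  rw [e, mul_apply]
  refine (norm_sum_le _ _).trans (Finset.sum_le_sum fun k _ => ?_)
  rw [norm_mul, conjTranspose_apply, norm_star]
  have hi : ∀ i, ‖S k i‖ ^ 2 ≤ ∑ l, ‖S k l‖ ^ 2 := fun i =>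
    Finset.single_le_sum (f := fun l => ‖S k l‖ ^ 2) (fun _ _ => by positivity)
      (Finset.mem_univ i)
  nlinarith [hi i, hi j, sq_nonneg (‖S k i‖ - ‖S k j‖)]

theorem norm_le_re_trace {A : Matrix ι ι ℂ} (hA : A.PosSemidef) : ‖A‖ ≤ A.trace.re :=
  (norm_le_iff (Complex.nonneg_iff.1 hA.trace_nonneg).1).2 (norm_apply_le_re_trace hA)

theorem isClosed_setOf_posSemidef : IsClosed {A : Matrix ι ι ℂ | A.PosSemidef} := by
  simp only [posSemidef_iff_dotProduct_mulVec, Set.ofPred_and, Set.ofPred_forall]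
  refine IsClosed.inter (isClosed_eq (by fun_prop) continuous_id)
    (isClosed_iInter fun x => isClosed_le continuous_const ?_)
  exact continuous_const.dotProduct (continuous_id.matrix_mulVec continuous_const)

/-- On the diagonal both summands are nonnegative multiples of diagonal entries, so the size of the
sum controls `A` alone: no cancellation can occur there. -/
theorem re_apply_self_le {a : ι → ℂ} (ha : ∀ i, ‖a i‖ < 1) (b : ι → ℂ) (hb : ∀ i, ‖b i‖ < 1)
    (A : Matrix ι ι ℂ) {B : Matrix ι ι ℂ} (hB : B.PosSemidef) (i : ι) :
    (A i i).re ≤ (1 - ‖a i‖ ^ 2)⁻¹ * ‖kernelMatrix 1 a A + kernelMatrix 1 b B‖ := by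
  have h1 : 0 < 1 - ‖a i‖ ^ 2 := by nlinarith [ha i, norm_nonneg (a i)]
  have h2 : 0 < 1 - ‖b i‖ ^ 2 := by nlinarith [hb i, norm_nonneg (b i)]
  have h3 := (Complex.nonneg_iff.1 (hB.diag_nonneg (i := i))).1
  rw [← div_eq_inv_mul, le_div_iff₀' h1]
  calc (1 - ‖a i‖ ^ 2) * (A i i).re
      ≤ (1 - ‖a i‖ ^ 2) * (A i i).re + (1 - ‖b i‖ ^ 2) * (B i i).re :=
        le_add_of_nonneg_right (mul_nonneg h2.le h3)
    _ = ((kernelMatrix 1 a A + kernelMatrix 1 b B) i i).re := by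
        rw [Matrix.add_apply, Complex.add_re, kernelMatrix_one_apply_self_re,
          kernelMatrix_one_apply_self_re]
    _ ≤ ‖kernelMatrix 1 a A + kernelMatrix 1 b B‖ :=
        (Complex.re_le_norm _).trans (norm_entry_le_entrywise_sup_norm _)

theorem norm_le_of_norm_kernelMatrix_add_le {a b : ι → ℂ} (ha : ∀ i, ‖a i‖ < 1)
    (hb : ∀ i, ‖b i‖ < 1) {A B : Matrix ι ι ℂ} (hA : A.PosSemidef) (hB : B.PosSemidef) {C : ℝ}
    (h : ‖kernelMatrix 1 a A + kernelMatrix 1 b B‖ ≤ C) :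
    ‖A‖ ≤ ∑ i, (1 - ‖a i‖ ^ 2)⁻¹ * C := by
  refine (norm_le_re_trace hA).trans ?_
  rw [trace, Complex.re_sum]
  refine Finset.sum_le_sum fun i _ => (re_apply_self_le ha b hb A hB i).trans ?_
  have h1 : 0 < 1 - ‖a i‖ ^ 2 := by nlinarith [ha i, norm_nonneg (a i)]
  gcongr

/-- A convergent sequence in the cone has bounded summands `A` and `B`, by the diagonal estimate
together with the trace bound for semidefinite matrices. Subsequences of both therefore converge. -/
theorem isClosed_modelCone {a b : ι → ℂ} (ha : ∀ i, ‖a i‖ < 1) (hb : ∀ i, ‖b i‖ < 1) :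
    IsClosed (modelCone a b) := by
  have : SequentialSpace (Matrix ι ι ℂ) := inferInstanceAs (SequentialSpace (ι → ι → ℂ))
  refine IsSeqClosed.isClosed fun M N hM hMN => ?_
  choose A B hA hB hAB using hM
  obtain ⟨C, hC⟩ := hMN.norm.bddAbove_range
  have hC' : ∀ k, ‖M k‖ ≤ C := fun k => hC ⟨k, rfl⟩
  have hbA : ∀ k, ‖A k‖ ≤ ∑ i, (1 - ‖a i‖ ^ 2)⁻¹ * C := fun k =>
    norm_le_of_norm_kernelMatrix_add_le ha hb (hA k) (hB k) (hAB k ▸ hC' k)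
  have hbB : ∀ k, ‖B k‖ ≤ ∑ i, (1 - ‖b i‖ ^ 2)⁻¹ * C := fun k =>
    norm_le_of_norm_kernelMatrix_add_le hb ha (hB k) (hA k) (by
      rw [add_comm]
      exact hAB k ▸ hC' k)
  have hprop : ProperSpace (Matrix ι ι ℂ) := FiniteDimensional.proper ℂ _
  obtain ⟨A', -, σ, hσ, hA'⟩ := tendsto_subseq_of_bounded
    (Metric.isBounded_closedBall (x := (0 : Matrix ι ι ℂ)) (r := ∑ i, (1 - ‖a i‖ ^ 2)⁻¹ * C))
    (x := A) fun k => by simpa using hbA k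
  obtain ⟨B', -, τ, hτ, hB'⟩ := tendsto_subseq_of_bounded
    (Metric.isBounded_closedBall (x := (0 : Matrix ι ι ℂ)) (r := ∑ i, (1 - ‖b i‖ ^ 2)⁻¹ * C))
    (x := B ∘ σ) fun k => by simpa using hbB (σ k)
  have hA'' := hA'.comp hτ.tendsto_atTop
  refine ⟨A', B', isClosed_setOf_posSemidef.mem_of_tendsto hA'' (.of_forall fun k => hA _),
    isClosed_setOf_posSemidef.mem_of_tendsto hB' (.of_forall fun k => hB _), ?_⟩
  refine tendsto_nhds_unique (hMN.comp (hσ.tendsto_atTop.comp hτ.tendsto_atTop)) ?_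
  refine Filter.Tendsto.congr (fun k => (hAB _).symm)
    ((((continuous_kernelMatrix 1 a).tendsto A').comp hA'').add
      (((continuous_kernelMatrix 1 b).tendsto B').comp hB'))

/-- The positive semidefinite `g` with `[(1 - ā_i a_j) g_ij] ≥ 0` and `[(1 - b̄_i b_j) g_ij] ≥ 0`. -/
def dualKernels (a b : ι → ℂ) : Set (Matrix ι ι ℂ) :=
  {g | g.PosSemidef ∧ (kernelMatrix 1 a g).PosSemidef ∧ (kernelMatrix 1 b g).PosSemidef}

/-- Multiplying `x` by `a` does not increase the form of `g`, and `aᴺ x → 0`, so the form at `x` is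
at least its limit `0`. Separation yields only a hermitian `g`; this supplies its positivity. -/
theorem posSemidef_of_kernelMatrix_posSemidef {a : ι → ℂ} (ha : ∀ i, ‖a i‖ < 1)
    {g : Matrix ι ι ℂ} (hg : g.IsHermitian) (h : (kernelMatrix 1 a g).PosSemidef) :
    g.PosSemidef := by
  refine .of_dotProduct_mulVec_nonneg hg fun x => ?_
  have hstep : ∀ x : ι → ℂ, star (a * x) ⬝ᵥ g *ᵥ (a * x) ≤ star x ⬝ᵥ g *ᵥ x := fun x => by
    have := h.dotProduct_mulVec_nonneg x
    rwa [star_dotProduct_kernelMatrix_mulVec, one_mul, sub_nonneg] at this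
  have hpow : ∀ N : ℕ, star (a ^ N * x) ⬝ᵥ g *ᵥ (a ^ N * x) ≤ star x ⬝ᵥ g *ᵥ x := fun N => by
    induction N with
    | zero => simp
    | succ N ih =>
      refine le_trans ?_ ih
      rw [pow_succ', mul_assoc]
      exact hstep _
  have hlim : Filter.Tendsto (fun N : ℕ => a ^ N * x) Filter.atTop (𝓝 0) := by
    rw [tendsto_pi_nhds]
    intro i
    simpa using (tendsto_pow_atTop_nhds_zero_of_norm_lt_one (ha i)).mul_const (x i)
  have hcont : Continuous fun y : ι → ℂ => star y ⬝ᵥ g *ᵥ y :=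
    continuous_star.dotProduct (continuous_const.matrix_mulVec continuous_id)
  have := (hcont.tendsto 0).comp hlim
  simp only [mulVec_zero, dotProduct_zero] at this
  exact le_of_tendsto' this hpow

theorem star_one_dotProduct_mulVec_one (M : Matrix ι ι ℂ) :
    star (1 : ι → ℂ) ⬝ᵥ M *ᵥ 1 = ∑ i, ∑ j, M i j := by
  simp [dotProduct, mulVec]

open Classical in
/-- Finite-dimensional duality: a hermitian matrix whose pairing with all kernels in
`dualKernels a b` is nonnegative lies in `modelCone a b`. -/
theorem mem_modelCone_of_forall_dualKernels {a b : ι → ℂ} (ha : ∀ i, ‖a i‖ < 1)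
    (hb : ∀ i, ‖b i‖ < 1) {M : Matrix ι ι ℂ} (hM : M.IsHermitian)
    (h : ∀ g ∈ dualKernels a b, 0 ≤ (∑ i, ∑ j, M i j * g i j).re) : M ∈ modelCone a b := by
  by_contra hMC
  have : LocallyConvexSpace ℝ (Matrix ι ι ℂ) := inferInstanceAs (LocallyConvexSpace ℝ (ι → ι → ℂ))
  obtain ⟨f, u, hfM, hfC⟩ := RCLike.geometric_hahn_banach_point_closed (𝕜 := ℂ)
    (convex_modelCone a b) (isClosed_modelCone ha hb) hMC
  have h0 : (0 : Matrix ι ι ℂ) ∈ modelCone a b :=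
    ⟨0, 0, .zero, .zero, by ext i j; simp [kernelMatrix]⟩
  have hu : u < 0 := by simpa using hfC 0 h0
  -- If `f` had negative real part at `N`, scaling `N` by `u / (f N).re` would attain the value `u`,
  -- which lies strictly below the cone's values.
  have hpos : ∀ N ∈ modelCone a b, 0 ≤ (f N).re := fun N hN => by
    by_contra! hneg
    have ht : 0 ≤ u / (f N).re := div_nonneg_of_nonpos hu.le hneg.le
    have h1 := hfC _ (smul_mem_modelCone hN ht)
    rw [← Complex.coe_smul, f.map_smul] at h1
    simp only [smul_eq_mul, RCLike.re_eq_complex_re, Complex.re_ofReal_mul] at h1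
    rw [div_mul_cancel₀ _ hneg.ne] at h1
    exact lt_irrefl _ h1
  let c : Matrix ι ι ℂ := of fun i j => f (single i j 1)
  have hfc : ∀ N : Matrix ι ι ℂ, f N = ∑ i, ∑ j, N i j * c i j := fun N => by
    conv_lhs => rw [matrix_eq_sum_single N]
    simp only [map_sum]
    refine Finset.sum_congr rfl fun i _ => Finset.sum_congr rfl fun j _ => ?_
    rw [show single i j (N i j) = N i j • single i j (1 : ℂ) by simp, f.map_smul, smul_eq_mul]
    rfl
  -- Taking the hermitian part of the coefficients retains exactly the real part of `f` on hermitian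
  -- matrices.
  let g : Matrix ι ι ℂ := of fun i j => (c i j + conj (c j i)) / 2
  have hg : g.IsHermitian := by
    ext i j
    simp [g, add_comm]
  have hfg : ∀ N : Matrix ι ι ℂ, N.IsHermitian →
      ∑ i, ∑ j, N i j * g i j = (((f N).re : ℝ) : ℂ) := fun N hN => by
    have e1 : ∑ i, ∑ j, N i j * conj (c j i) = conj (f N) := by
      rw [hfc, Finset.sum_comm]
      simp only [map_sum, map_mul]
      refine Finset.sum_congr rfl fun i _ => Finset.sum_congr rfl fun j _ => ?_
      rw [← hN.apply j i]
      rfl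
    have e2 : ∑ i, ∑ j, N i j * g i j = (f N + conj (f N)) / 2 := by
      rw [← e1, hfc, ← Finset.sum_add_distrib, Finset.sum_div]
      refine Finset.sum_congr rfl fun i _ => ?_
      rw [← Finset.sum_add_distrib, Finset.sum_div]
      refine Finset.sum_congr rfl fun j _ => ?_
      simp only [g, of_apply]
      ring
    rw [e2, Complex.add_conj]
    push_cast
    ring
  have hpsd : ∀ w : ι → ℂ, (∀ A : Matrix ι ι ℂ, A.PosSemidef → kernelMatrix 1 w A ∈ modelCone a b) →
      (kernelMatrix 1 w g).PosSemidef := fun w hw => by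
    have e1 : (1 : ℂ) = ((1 : ℝ) : ℂ) := by simp
    refine .of_dotProduct_mulVec_nonneg ?_ fun x => ?_
    · rw [e1]
      exact isHermitian_kernelMatrix w hg
    · have hA := posSemidef_vecMulVec_star_self x
      have hK : (kernelMatrix 1 w (vecMulVec (star x) x)).IsHermitian := by
        rw [e1]
        exact isHermitian_kernelMatrix w hA.isHermitian
      have e2 : star x ⬝ᵥ kernelMatrix 1 w g *ᵥ x =
          ∑ i, ∑ j, kernelMatrix 1 w (vecMulVec (star x) x) i j * g i j := by
        simp only [dotProduct, mulVec, Finset.mul_sum]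
        refine Finset.sum_congr rfl fun i _ => Finset.sum_congr rfl fun j _ => ?_
        simp only [kernelMatrix, of_apply, vecMulVec_apply]
        ring
      rw [e2, hfg _ hK, Complex.zero_le_real]
      exact hpos _ (hw _ hA)
  have hka : (kernelMatrix 1 a g).PosSemidef := hpsd a fun A hA =>
    ⟨A, 0, hA, .zero, by ext i j; simp [kernelMatrix]⟩
  have hkb : (kernelMatrix 1 b g).PosSemidef := hpsd b fun B hB =>
    ⟨0, B, .zero, hB, by ext i j; simp [kernelMatrix]⟩
  have h1 := h g ⟨posSemidef_of_kernelMatrix_posSemidef ha hg hka, hka, hkb⟩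
  rw [hfg M hM, Complex.ofReal_re] at h1
  have : (f M).re < u := hfM
  linarith

end Cone

theorem norm_div_lt_one {δ : ℝ} (hδ : 0 < δ) {l : ℂ} (hl : l ∈ annulus δ) : ‖(δ : ℂ) / l‖ < 1 := by
  rw [norm_div, Complex.norm_real, Real.norm_of_nonneg hδ.le, div_lt_one (hδ.trans hl.1)]
  exact hl.1

theorem solvable_of_forall_dualKernels {δ : ℝ} (hδ : 0 < δ) (hδ1 : δ < 1) {n : ℕ}
    {lam z : Fin n → ℂ} (hlam : ∀ j, lam j ∈ annulus δ)
    (h : ∀ g ∈ dualKernels lam (fun j => δ / lam j),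
      0 ≤ (star (1 : Fin n → ℂ) ⬝ᵥ kernelMatrix 1 z g *ᵥ 1).re) :
    Solvable.{u} δ lam z := by
  obtain ⟨A, B, hA, hB, hAB⟩ := mem_modelCone_of_forall_dualKernels
    (a := lam) (b := fun j => δ / lam j) (M := kernelMatrix 1 z (of fun _ _ => 1))
    (fun i => (hlam i).2) (fun i => norm_div_lt_one hδ (hlam i))
    (by
      have := isHermitian_kernelMatrix (c := 1) z (g := of fun _ _ => (1 : ℂ))
        (by ext i j; simp)
      simpa using this)
    fun g hg => by
      have := h g hg
      rw [star_one_dotProduct_mulVec_one] at this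
      simpa [kernelMatrix] using this
  exact solvable_of_eq_kernelMatrix_add hδ hδ1 hlam hA hB hAB

/-! ### Null spaces of semidefinite kernels -/

section Degenerate

variable {ι : Type*}

/-- The indicator of the set where the diagonal of `g` vanishes. -/
noncomputable def zeroIndicator (g : Matrix ι ι ℂ) : ι → ℂ := fun i => if g i i = 0 then 1 else 0

theorem zeroIndicator_nonneg (g : Matrix ι ι ℂ) : 0 ≤ zeroIndicator g := fun i => by
  simp only [zeroIndicator, Pi.zero_apply]
  split_ifs <;> simp

/-- When `g x = 0`, the form of the kernel matrix at `x` reduces to minus the form of `g` at `a x`,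
so the latter must vanish. The null space is thus invariant under multiplication by `a`. -/
theorem mulVec_mul_eq_zero [Fintype ι] {a : ι → ℂ} {g : Matrix ι ι ℂ} (hg : g.PosSemidef)
    (h : (kernelMatrix 1 a g).PosSemidef) {x : ι → ℂ} (hx : g *ᵥ x = 0) : g *ᵥ (a * x) = 0 := by
  have h1 := h.dotProduct_mulVec_nonneg x
  rw [star_dotProduct_kernelMatrix_mulVec, hx, dotProduct_zero, mul_zero, zero_sub,
    Left.nonneg_neg_iff] at h1
  exact (hg.dotProduct_mulVec_zero_iff _).1 (h1.antisymm (hg.dotProduct_mulVec_nonneg _))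

variable [DecidableEq ι]

theorem kernelMatrix_diagonal (w d : ι → ℂ) :
    kernelMatrix 1 w (diagonal d) = diagonal fun i => ((1 - ‖w i‖ ^ 2 : ℝ) : ℂ) * d i := by
  ext i j
  by_cases hij : i = j
  · subst hij
    simp [kernelMatrix, Complex.conj_mul']
  · simp [kernelMatrix, hij]

theorem kernelMatrix_diagonal_posSemidef {w d : ι → ℂ} (hw : ∀ i, ‖w i‖ < 1) (hd : 0 ≤ d) :
    (kernelMatrix 1 w (diagonal d)).PosSemidef := by
  rw [kernelMatrix_diagonal]
  refine .diagonal fun i => mul_nonneg (Complex.zero_le_real.2 ?_) (hd i)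
  nlinarith [hw i, norm_nonneg (w i)]

variable [Fintype ι]

/-- If the `a i` are distinct, the kernel of `g` is spanned by coordinate vectors. -/
theorem apply_self_eq_zero_of_mulVec_eq_zero {a : ι → ℂ} (ha : Function.Injective a)
    {g : Matrix ι ι ℂ} (hg : g.PosSemidef) (h : (kernelMatrix 1 a g).PosSemidef) {x : ι → ℂ}
    (hx : g *ᵥ x = 0) {i : ι} (hi : x i ≠ 0) : g i i = 0 := by
  -- By invariance the null space is stable under polynomials in `a`. The product over all `k ≠ i`
  -- isolates the `i`-th coordinate.
  have key : ∀ s : Finset ι, g *ᵥ ((fun j => ∏ k ∈ s, (a j - a k)) * x) = 0 := fun s => by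
    induction s using Finset.induction_on with
    | empty => simpa [← Pi.one_def] using hx
    | insert k s hk ih =>
      have e : (fun j => ∏ l ∈ insert k s, (a j - a l)) * x =
          a * ((fun j => ∏ l ∈ s, (a j - a l)) * x) -
            a k • ((fun j => ∏ l ∈ s, (a j - a l)) * x) := by
        ext j
        simp only [Finset.prod_insert hk, Pi.mul_apply, Pi.sub_apply, Pi.smul_apply, smul_eq_mul]
        ring
      rw [e, mulVec_sub, mulVec_smul, ih, mulVec_mul_eq_zero hg h ih, smul_zero, sub_zero]
  have h1 := congrFun (key (Finset.univ.erase i)) i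
  rw [mulVec, dotProduct, Finset.sum_eq_single i] at h1
  · simp only [Pi.mul_apply, Pi.zero_apply, mul_eq_zero, hi, or_false] at h1
    refine h1.resolve_right (Finset.prod_ne_zero_iff.2 fun k hk => ?_)
    exact sub_ne_zero.2 fun hik => (Finset.mem_erase.1 hk).1 (ha hik.symm)
  · intro j _ hj
    have : ∏ k ∈ Finset.univ.erase i, (a j - a k) = 0 :=
      Finset.prod_eq_zero (Finset.mem_erase.2 ⟨hj, Finset.mem_univ j⟩) (sub_self _)
    simp [this]
  · simp

theorem apply_eq_zero_of_apply_self_eq_zero {g : Matrix ι ι ℂ} (hg : g.PosSemidef) {j : ι}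
    (hj : g j j = 0) (i : ι) : g i j = 0 := by
  have := (hg.dotProduct_mulVec_zero_iff (Pi.single j 1)).1 (by simp [hj])
  simpa using congrFun this i

/-- Null vectors of `g` are supported where its diagonal vanishes, and the added term is strictly
positive there. -/
theorem posDef_add_diagonal_zeroIndicator {a : ι → ℂ} (ha : Function.Injective a)
    {g : Matrix ι ι ℂ} (hg : g.PosSemidef) (h : (kernelMatrix 1 a g).PosSemidef) :
    (g + diagonal (zeroIndicator g)).PosDef := by
  have hd : (diagonal (zeroIndicator g)).PosSemidef := .diagonal (zeroIndicator_nonneg g)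
  refine .of_dotProduct_mulVec_pos (hg.add hd).isHermitian fun x hx => ?_
  have h1 := hg.dotProduct_mulVec_nonneg x
  have h2 := hd.dotProduct_mulVec_nonneg x
  rw [add_mulVec, dotProduct_add]
  refine lt_of_le_of_ne (add_nonneg h1 h2) fun h0 => hx ?_
  obtain ⟨e1, e2⟩ := (add_eq_zero_iff_of_nonneg h1 h2).1 h0.symm
  rw [hg.dotProduct_mulVec_zero_iff] at e1
  rw [hd.dotProduct_mulVec_zero_iff] at e2
  ext i
  by_contra hi
  have := congrFun e2 i
  rw [mulVec_diagonal] at this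
  simp [zeroIndicator, apply_self_eq_zero_of_mulVec_eq_zero ha hg h e1 hi] at this
  exact hi this

end Degenerate

/-! ### Singular Pick matrices and strict solutions -/

section Extremality

variable {n : ℕ}

theorem add_diagonal_mem_dpKernels {δ : ℝ} (hδ : 0 < δ) {lam : Fin n → ℂ}
    (hlam : ∀ j, lam j ∈ annulus δ) {g : Matrix (Fin n) (Fin n) ℂ}
    (hg : g ∈ dualKernels lam fun j => δ / lam j) {d : Fin n → ℂ} (hd : 0 ≤ d)
    (hgd : (g + diagonal d).PosDef) : g + diagonal d ∈ dpKernels δ lam := by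
  rw [mem_dpKernels_iff, kernelMatrix_add, kernelMatrix_add]
  exact ⟨hgd, hg.2.1.add (kernelMatrix_diagonal_posSemidef (fun i => (hlam i).2) hd),
    hg.2.2.add (kernelMatrix_diagonal_posSemidef (fun i => norm_div_lt_one hδ (hlam i)) hd)⟩

/-- Positivity of the Pick matrices passes from definite to semidefinite kernels. -/
theorem kernelMatrix_posSemidef_of_mem_dualKernels {δ : ℝ} (hδ : 0 < δ) {lam z : Fin n → ℂ}
    (hlam : ∀ j, lam j ∈ annulus δ)
    (h : ∀ g ∈ dpKernels δ lam, (pickMatrix z g).PosSemidef) {g : Matrix (Fin n) (Fin n) ℂ}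
    (hg : g ∈ dualKernels lam fun j => δ / lam j) : (kernelMatrix 1 z g).PosSemidef := by
  -- For `t > 0` the perturbation `g + t I` is a positive definite kernel; the conclusion follows by
  -- letting `t → 0`.
  have hcont : Continuous fun t : ℝ =>
      kernelMatrix 1 z (g + diagonal fun _ => (t : ℂ)) :=
    (continuous_kernelMatrix 1 z).comp
      (continuous_const.add (Continuous.matrix_diagonal (by fun_prop)))
  have hlim := (hcont.tendsto 0).mono_left (nhdsWithin_le_nhds (s := Set.Ioi 0))
  simp only [Complex.ofReal_zero, diagonal_zero, add_zero] at hlim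
  refine isClosed_setOf_posSemidef.mem_of_tendsto hlim ?_
  filter_upwards [self_mem_nhdsWithin] with t ht
  have ht' : (0 : ℂ) < t := Complex.zero_lt_real.2 ht
  exact h _ (add_diagonal_mem_dpKernels hδ hlam hg (fun _ => ht'.le)
    (PosDef.posSemidef_add hg.1 (.diagonal fun _ => ht')))

theorem rank_lt_of_mulVec_eq_zero {M : Matrix (Fin n) (Fin n) ℂ} {v : Fin n → ℂ} (hv : v ≠ 0)
    (h : M *ᵥ v = 0) : M.rank < n := by
  have h1 := LinearMap.finrank_range_add_finrank_ker M.mulVecLin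
  have h2 : 0 < Module.finrank ℂ (LinearMap.ker M.mulVecLin) := by
    rw [Module.finrank_pos_iff_exists_ne_zero]
    exact ⟨⟨v, by simpa using h⟩, fun h0 => hv (congrArg Subtype.val h0)⟩
  rw [Module.finrank_fin_fun] at h1
  rw [Matrix.rank]
  omega

/-- The diagonal repair alters `g` only at indices whose column is zero. Deleting those indices from
the null vector `1` therefore leaves a null vector of the new Pick matrix, and it is nonzero because
`g` is. -/
theorem exists_mem_dpKernels_rank_lt {δ : ℝ} (hδ : 0 < δ) {lam z : Fin n → ℂ}
    (hlam : ∀ j, lam j ∈ annulus δ) (hinj : Function.Injective lam)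
    {g : Matrix (Fin n) (Fin n) ℂ} (hg : g ∈ dualKernels lam fun j => δ / lam j) (hg0 : g ≠ 0)
    (h : kernelMatrix 1 z g *ᵥ 1 = 0) : ∃ g ∈ dpKernels δ lam, (pickMatrix z g).rank < n := by
  refine ⟨_, add_diagonal_mem_dpKernels hδ hlam hg (zeroIndicator_nonneg g)
    (posDef_add_diagonal_zeroIndicator hinj hg.1 hg.2.1),
    rank_lt_of_mulVec_eq_zero (v := 1 - zeroIndicator g) (fun h0 => hg0 ?_) ?_⟩
  · ext i j
    refine apply_eq_zero_of_apply_self_eq_zero hg.1 ?_ i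
    by_contra hj
    simpa [zeroIndicator, hj] using congrFun h0 j
  · rw [← h, pickMatrix_eq_kernelMatrix]
    ext i
    simp only [mulVec, dotProduct]
    refine Finset.sum_congr rfl fun j _ => ?_
    by_cases hj : g j j = 0
    · simp [kernelMatrix, zeroIndicator, hj, apply_eq_zero_of_apply_self_eq_zero hg.1 hj i]
    · have : diagonal (zeroIndicator g) i j = 0 := by
        rw [diagonal_apply]
        split_ifs with hij
        · simp [zeroIndicator, hij, hj]
        · rfl
      simp [kernelMatrix, this, zeroIndicator, hj]

/-- All coordinates of `1` are nonzero, so `g 1 = 0` would make the whole diagonal of `g`, hence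
`g`, vanish. -/
theorem star_one_dotProduct_mulVec_one_re_pos [NeZero n] {a b : Fin n → ℂ}
    (ha : Function.Injective a) {g : Matrix (Fin n) (Fin n) ℂ} (hg : g ∈ dualKernels a b)
    (hg0 : g ≠ 0) : 0 < (star (1 : Fin n → ℂ) ⬝ᵥ g *ᵥ 1).re := by
  have h1 := hg.1.dotProduct_mulVec_nonneg 1
  refine (Complex.pos_iff.1 (lt_of_le_of_ne h1 fun h0 => hg0 ?_)).1
  have h2 := (hg.1.dotProduct_mulVec_zero_iff 1).1 h0.symm
  ext i j
  exact apply_eq_zero_of_apply_self_eq_zero hg.1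
    (apply_self_eq_zero_of_mulVec_eq_zero ha hg.1 hg.2.1 h2 (by simp)) i

open scoped Matrix.Norms.Elementwise in
theorem isCompact_dualKernels_inter_trace_eq_one (a b : Fin n → ℂ) :
    IsCompact (dualKernels a b ∩ {g | g.trace = 1}) := by
  have hprop : ProperSpace (Matrix (Fin n) (Fin n) ℂ) := FiniteDimensional.proper ℂ _
  refine Metric.isCompact_of_isClosed_isBounded ?_ ?_
  · refine IsClosed.inter ?_ (isClosed_eq (Continuous.matrix_trace continuous_id) continuous_const)
    exact isClosed_setOf_posSemidef.inter
      ((isClosed_setOf_posSemidef.preimage (continuous_kernelMatrix 1 a)).inter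
        (isClosed_setOf_posSemidef.preimage (continuous_kernelMatrix 1 b)))
  · refine (Metric.isBounded_closedBall (x := 0) (r := 1)).subset fun g hg => ?_
    rw [mem_closedBall_zero_iff]
    refine (norm_le_re_trace hg.1.1).trans ?_
    rw [hg.2, Complex.one_re]

theorem smul_mem_dualKernels {a b : Fin n → ℂ} {g : Matrix (Fin n) (Fin n) ℂ}
    (hg : g ∈ dualKernels a b) {t : ℝ} (ht : 0 ≤ t) : t • g ∈ dualKernels a b := by
  refine ⟨hg.1.smul ht, ?_, ?_⟩
  · rw [kernelMatrix_smul]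
    exact hg.2.1.smul ht
  · rw [kernelMatrix_smul]
    exact hg.2.2.smul ht

/-- If no Pick matrix is singular, the Pick matrices are uniformly positive. -/
theorem exists_pos_forall_dualKernels_le {δ : ℝ} (hδ : 0 < δ) {lam z : Fin n → ℂ}
    (hlam : ∀ j, lam j ∈ annulus δ) (hinj : Function.Injective lam)
    (h : ∀ g ∈ dpKernels δ lam, (pickMatrix z g).PosSemidef)
    (hrank : ¬ ∃ g ∈ dpKernels δ lam, (pickMatrix z g).rank < n) :
    ∃ ε : ℝ, 0 < ε ∧ ∀ g ∈ dualKernels lam fun j => δ / lam j,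
      ε * (star (1 : Fin n → ℂ) ⬝ᵥ g *ᵥ 1).re ≤
        (star (1 : Fin n → ℂ) ⬝ᵥ kernelMatrix 1 z g *ᵥ 1).re := by
  rcases Nat.eq_zero_or_pos n with rfl | hn
  · exact ⟨1, one_pos, fun g _ => by simp [dotProduct]⟩
  have : NeZero n := ⟨hn.ne'⟩
  set b : Fin n → ℂ := fun j => δ / lam j
  have hK := isCompact_dualKernels_inter_trace_eq_one lam b
  have hne : (dualKernels lam b ∩ {g | g.trace = 1}).Nonempty := by
    have h1 : (1 : Matrix (Fin n) (Fin n) ℂ) ∈ dualKernels lam b := by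
      rw [← diagonal_one]
      exact ⟨.diagonal zero_le_one,
        kernelMatrix_diagonal_posSemidef (fun i => (hlam i).2) zero_le_one,
        kernelMatrix_diagonal_posSemidef (fun i => norm_div_lt_one hδ (hlam i)) zero_le_one⟩
    refine ⟨(n : ℝ)⁻¹ • 1, smul_mem_dualKernels h1 (by positivity), ?_⟩
    rw [Set.mem_ofPred_eq, trace_smul, trace_one, Fintype.card_fin, ← Complex.coe_smul]
    simp [hn.ne']
  have hne0 : ∀ g : Matrix (Fin n) (Fin n) ℂ, g.trace = 1 → g ≠ 0 := by
    rintro g hg rfl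
    simp at hg
  have hq : Continuous fun g : Matrix (Fin n) (Fin n) ℂ => (star (1 : Fin n → ℂ) ⬝ᵥ g *ᵥ 1).re :=
    Complex.continuous_re.comp
      (continuous_const.dotProduct (continuous_id.matrix_mulVec continuous_const))
  -- The ratio of the two forms is invariant under positive scaling, so its minimum over the compact
  -- trace-one slice serves as `ε` for the whole cone.
  obtain ⟨g₀, hg₀, hmin⟩ := hK.exists_isMinOn hne
    (f := fun g => (star (1 : Fin n → ℂ) ⬝ᵥ kernelMatrix 1 z g *ᵥ 1).re /
      (star (1 : Fin n → ℂ) ⬝ᵥ g *ᵥ 1).re)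
    ((hq.comp (continuous_kernelMatrix 1 z)).continuousOn.div hq.continuousOn fun g hg =>
      (star_one_dotProduct_mulVec_one_re_pos hinj hg.1 (hne0 g hg.2)).ne')
  have hpos₀ := star_one_dotProduct_mulVec_one_re_pos hinj hg₀.1 (hne0 g₀ hg₀.2)
  refine ⟨(star (1 : Fin n → ℂ) ⬝ᵥ kernelMatrix 1 z g₀ *ᵥ 1).re /
      (star (1 : Fin n → ℂ) ⬝ᵥ g₀ *ᵥ 1).re, div_pos (lt_of_not_ge fun hle => hrank ?_) hpos₀, fun g hg => ?_⟩
  -- If the minimum were not positive, the semidefinite Pick matrix of `g₀` would annihilate `1`,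
  -- and the repaired kernel would have a singular Pick matrix.
  · have hpsd := kernelMatrix_posSemidef_of_mem_dualKernels hδ hlam h hg₀.1
    refine exists_mem_dpKernels_rank_lt hδ hlam hinj hg₀.1 (hne0 g₀ hg₀.2)
      ((hpsd.dotProduct_mulVec_zero_iff 1).1 ?_)
    obtain ⟨h1, h2⟩ := Complex.nonneg_iff.1 (hpsd.dotProduct_mulVec_nonneg 1)
    exact Complex.ext (le_antisymm hle h1) h2.symm
  · obtain ⟨ht1, ht2⟩ := Complex.nonneg_iff.1 hg.1.trace_nonneg
    rcases ht1.eq_or_lt with ht0 | ht0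
    · have hg0 : g = 0 := by
        ext i j
        have := norm_apply_le_re_trace hg.1 i j
        rw [← ht0] at this
        exact norm_le_zero_iff.1 this
      have hk : kernelMatrix 1 z (0 : Matrix (Fin n) (Fin n) ℂ) = 0 := by
        ext i j
        simp [kernelMatrix]
      simp [hg0, hk]
    · have hmem : (g.trace.re)⁻¹ • g ∈ dualKernels lam b ∩ {g | g.trace = 1} := by
        refine ⟨smul_mem_dualKernels hg (by positivity), ?_⟩
        have : g.trace = (g.trace.re : ℂ) := Complex.ext rfl ht2.symm
        rw [Set.mem_ofPred_eq, trace_smul, ← Complex.coe_smul, this, Complex.ofReal_re, smul_eq_mul,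
          ← Complex.ofReal_mul, inv_mul_cancel₀ ht0.ne', Complex.ofReal_one]
      have hm := isMinOn_iff.1 hmin _ hmem
      have hqs : ∀ M : Matrix (Fin n) (Fin n) ℂ, (star (1 : Fin n → ℂ) ⬝ᵥ
          ((g.trace.re)⁻¹ • M) *ᵥ 1).re = (g.trace.re)⁻¹ * (star (1 : Fin n → ℂ) ⬝ᵥ M *ᵥ 1).re := by
        intro M
        rw [smul_mulVec, dotProduct_smul, Complex.smul_re, smul_eq_mul]
      have hg0 : g ≠ 0 := by
        rintro rfl
        simp at ht0
      rw [kernelMatrix_smul, hqs, hqs, mul_div_mul_left _ _ (inv_pos.2 ht0).ne'] at hm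
      exact (le_div_iff₀ (star_one_dotProduct_mulVec_one_re_pos hinj hg hg0)).1 hm

/-- If the Pick matrices are uniformly positive, some interpolant has dp-norm less than `1`. -/
theorem exists_dpNorm_lt_one_of_forall_dualKernels_le {δ : ℝ} (hδ : 0 < δ) (hδ1 : δ < 1)
    -- The proof takes `η` at most `1/2` to keep `r² = 1 - η` positive.
    {lam z : Fin n → ℂ} (hlam : ∀ j, lam j ∈ annulus δ) {ε : ℝ} (hε : 0 < ε)
    (h : ∀ g ∈ dualKernels lam fun j => δ / lam j,
      ε * (star (1 : Fin n → ℂ) ⬝ᵥ g *ᵥ 1).re ≤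
        (star (1 : Fin n → ℂ) ⬝ᵥ kernelMatrix 1 z g *ᵥ 1).re) :
    ∃ φ ∈ HInfDP.{u} δ, dpNorm.{u} δ φ < 1 ∧ ∀ j, φ (lam j) = z j := by
  set η := min ε (1 / 2)
  have hη0 : 0 < η := lt_min hε (by norm_num)
  have hη1 : η ≤ 1 / 2 := min_le_right _ _
  set r := Real.sqrt (1 - η)
  have hr2 : r ^ 2 = 1 - η := Real.sq_sqrt (by linarith)
  have hr0 : 0 < r := Real.sqrt_pos.2 (by linarith)
  have hr1 : r < 1 := by nlinarith
  have hrC : (r : ℂ) ≠ 0 := Complex.ofReal_ne_zero.2 hr0.ne'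
  obtain ⟨φ, ⟨hφ, hφ1⟩, hφz⟩ := solvable_of_forall_dualKernels.{u} hδ hδ1 hlam
    (z := fun j => z j / r) fun g hg => by
      -- Enlarging the targets by `1/r` uses up exactly `η g` of the margin.
      have e : kernelMatrix 1 (fun j => z j / r) g =
          (r ^ 2)⁻¹ • (kernelMatrix 1 z g - η • g) := by
        ext i j
        have : ((r : ℂ)) ^ 2 = 1 - η := by exact_mod_cast hr2
        have hη : (η : ℂ) = 1 - (r : ℂ) ^ 2 := by rw [this]; ring
        simp only [kernelMatrix, of_apply, Matrix.smul_apply, Matrix.sub_apply, map_div₀,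
          Complex.conj_ofReal, Complex.real_smul, hη]
        push_cast
        field_simp
        ring
      rw [e, smul_mulVec, dotProduct_smul, sub_mulVec, dotProduct_sub, smul_mulVec,
        dotProduct_smul, Complex.smul_re, Complex.sub_re, Complex.smul_re, smul_eq_mul, smul_eq_mul]
      refine mul_nonneg (by positivity) (sub_nonneg.2 (le_trans ?_ (h g hg)))
      gcongr
      · exact (Complex.nonneg_iff.1 (hg.1.dotProduct_mulVec_nonneg 1)).1
      · exact min_le_left _ _
  have hle : dpNorm.{u} δ (fun w => r * φ w) ≤ ENNReal.ofReal r := dpNorm_le fun H _ _ _ X hX => by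
    rw [calculus_const_mul hδ hδ1 hX.2 _ hφ, norm_smul, Complex.norm_real,
      Real.norm_of_nonneg hr0.le]
    exact mul_le_of_le_one_right hr0.le
      (norm_calculus_le zero_le_one (by simpa using hφ1) hX)
  have hlt : dpNorm.{u} δ (fun w => r * φ w) < 1 :=
    hle.trans_lt (by rwa [ENNReal.ofReal_lt_one])
  refine ⟨_, ⟨hφ.const_mul _, hlt.trans ENNReal.one_lt_top⟩, hlt, fun j => ?_⟩
  rw [hφz]
  field_simp

/-- With `r` the dp-norm of `φ`, the Pick matrix is a positive semidefinite matrix plus `(1 - r²)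
g`, which is positive definite. -/
theorem rank_eq_of_dpNorm_lt_one {δ : ℝ} (hδ : 0 < δ) (hδ1 : δ < 1) {lam : Fin n → ℂ}
    (hlam : ∀ j, lam j ∈ annulus δ) {g : Matrix (Fin n) (Fin n) ℂ} (hg : g ∈ dpKernels δ lam)
    {φ : ℂ → ℂ} (hφ : DifferentiableOn ℂ φ (annulus δ)) (hφ1 : dpNorm.{u} δ φ < 1) :
    (pickMatrix (fun j => φ (lam j)) g).rank = n := by
  set r := (dpNorm.{u} δ φ).toReal
  have hr0 : 0 ≤ r := ENNReal.toReal_nonneg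
  have hr1 : r < 1 := by
    have := (ENNReal.toReal_lt_toReal (hφ1.trans ENNReal.one_lt_top).ne ENNReal.one_ne_top).2 hφ1
    simpa using this
  have h1 := kernelMatrix_posSemidef_of_mem_dpKernels hδ hδ1 hlam hg hφ hr0
    (ENNReal.ofReal_toReal (hφ1.trans ENNReal.one_lt_top).ne).ge
  have e : pickMatrix (fun j => φ (lam j)) g =
      kernelMatrix ((r ^ 2 : ℝ) : ℂ) (fun j => φ (lam j)) g + (1 - r ^ 2) • g := by
    ext i j
    simp only [pickMatrix, kernelMatrix, of_apply, Matrix.add_apply, Matrix.smul_apply,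
      Complex.real_smul]
    push_cast
    ring
  have hpd : (pickMatrix (fun j => φ (lam j)) g).PosDef := by
    rw [e]
    refine PosDef.posSemidef_add h1 (hg.1.smul ?_)
    nlinarith
  rw [rank_of_isUnit _ hpd.isUnit, Fintype.card_fin]

end Extremality

end DPPick

theorem theorem6p2 (δ : ℝ) (hδ0 : 0 < δ) (hδ1 : δ < 1) (n : ℕ) (lam z : Fin n → ℂ)
    (hlam : ∀ j, lam j ∈ DPPick.annulus δ) (hinj : Function.Injective lam) :
    DPPick.ExtremallySolvable.{u} δ lam z ↔
      (∀ g ∈ DPPick.dpKernels δ lam, (DPPick.pickMatrix z g).PosSemidef) ∧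
        ∃ g ∈ DPPick.dpKernels δ lam, (DPPick.pickMatrix z g).rank < n := by
  constructor
  · rintro ⟨⟨φ, ⟨hφ, hφ1⟩, hφz⟩, hno⟩
    have hpick : ∀ g ∈ DPPick.dpKernels δ lam, (DPPick.pickMatrix z g).PosSemidef := fun g hg => by
      have := DPPick.kernelMatrix_posSemidef_of_mem_dpKernels hδ0 hδ1 hlam hg hφ zero_le_one
        (by simpa using hφ1)
      simpa [hφz, DPPick.pickMatrix_eq_kernelMatrix] using this
    refine ⟨hpick, ?_⟩
    by_contra hrank
    obtain ⟨ε, hε, h⟩ := DPPick.exists_pos_forall_dualKernels_le hδ0 hlam hinj hpick hrank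
    exact hno (DPPick.exists_dpNorm_lt_one_of_forall_dualKernels_le hδ0 hδ1 hlam hε h)
  · rintro ⟨hpick, g, hg, hrank⟩
    refine ⟨DPPick.solvable_of_forall_dualKernels hδ0 hδ1 hlam fun g hg => ?_, ?_⟩
    · exact (Complex.nonneg_iff.1 ((DPPick.kernelMatrix_posSemidef_of_mem_dualKernels hδ0 hlam
        hpick hg).dotProduct_mulVec_nonneg 1)).1
    · rintro ⟨φ, ⟨hφ, -⟩, hφ1, hφz⟩
      have := DPPick.rank_eq_of_dpNorm_lt_one hδ0 hδ1 hlam hg hφ hφ1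
      simp only [hφz] at this
      exact hrank.ne this
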